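/- Let a vector $d\in\mathbb{Z}^n$ be called TU-appendable to a totally unimodular matrix $T\in\{-1,0,1\}^{k\times n}$ if the matrix $\begin{pmatrix}T\\ d^\top\end{pmatrix}$ is totally unimodular, and let a vector $x\in\mathbb{Z}^n$ be called elementary with respect to $T$ if $d^\top x\in\{-1,0,1\}$ for all $d$ that are TU-appendable to $T$. (Decomposition lemma) Let $T\in\{-1,0,1\}^{k\times n}$ be a totally unimodular matrix, let $b\in\mathbb{Z}^k$, and let $x_0,y\in\mathbb{Z}^n$ be two solutions of the system $Tx\leq b$. Then one can determine in strongly polynomial time vectors $y^1,\ldots,y^n\in\mathbb{Z}^n$ and coefficients $\lambda_1,\ldots,\lambda_n\in\mathbb{Z}_{\geq 0}$ such that $y-x_0=\sum_{i=1}^n\lambda_i y^i$ and 1. $y^1,\ldots,y^n$ are elementary with respect to $T$; 2. for all $\mu_1,\ldots,\mu_n\in\mathbb{Z}_{\geq 0}$ with $\mu_i\leq\lambda_i$ for all $i\in\{1,\ldots,n\}$, the vector $\tilde y=x_0+\sum_{i=1}^n\mu_i y^i$ satisfies $T\tilde y\leq b$. Here strongly polynomial time means that a single algorithm, on input $(k,n,T,b,x_0,y)$,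 performs a number of elementary operations (integer addition, subtraction, multiplication, comparison, and memory access) bounded by a polynomial in the number of integers in the input, while all integers occurring in the computation have binary encoding length bounded by a polynomial in the total encoding length of the input. -/

import Mathlib

open Matrix

/-! ### Totally unimodular systems -/

/-- `d` is TU-appendable to `T`: the matrix `T` with the extra row `dᵀ` is totally unimodular. -/
def TUAppendable {k n : ℕ} (T : Matrix (Fin k) (Fin n) ℤ) (d : Fin n → ℤ) : Prop :=
  (Matrix.fromRows T (Matrix.replicateRow (Fin 1) d)).IsTotallyUnimodular

/-- `x` is elementary w.r.t. `T`: `dᵀ x ∈ {-1, 0, 1}` for all `d` that are TU-appendable to `T`. -/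
def IsElementary {k n : ℕ} (T : Matrix (Fin k) (Fin n) ℤ) (x : Fin n → ℤ) : Prop :=
  ∀ d : Fin n → ℤ, TUAppendable T d → d ⬝ᵥ x ∈ ({-1, 0, 1} : Set ℤ)

/-- The coefficients `lam i` and the vectors `Y i`, for `i = 1, …, n`, decompose `y - x₀` in the
required way with respect to the system `T x ≤ b`. -/
structure IsDecomposition {k n : ℕ} (T : Matrix (Fin k) (Fin n) ℤ) (b : Fin k → ℤ)
    (x₀ y : Fin n → ℤ) (lam : Fin n → ℤ) (Y : Fin n → Fin n → ℤ) : Prop where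
  nonneg : ∀ i, 0 ≤ lam i
  sum_eq : y - x₀ = ∑ i, lam i • Y i
  elementary : ∀ i, IsElementary T (Y i)
  feasible : ∀ mu : Fin n → ℤ, (∀ i, 0 ≤ mu i ∧ mu i ≤ lam i) →
    T *ᵥ (x₀ + ∑ i, mu i • Y i) ≤ b

/-! ### The machine model

A random access machine over the integers with unit-cost operations `+`, `-`, `*`, comparison and
indirect addressing, programmed by structured programs. There is neither division nor rounding, so
running times here are at least those in the usual arithmetic model. -/

/-- Memory: named two-dimensional arrays of integers;
`σ a i j` is the content of cell `(i, j)` of array `a`. -/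
abbrev Mem : Type := ℕ → ℤ → ℤ → ℤ

/-- Write the value `v` into cell `(i, j)` of array `a`. -/
def Mem.write (σ : Mem) (a : ℕ) (i j v : ℤ) : Mem :=
  fun a' i' j' => if a' = a ∧ i' = i ∧ j' = j then v else σ a' i' j'

/-- Integer expressions. -/
inductive Expr : Type
  | const (c : ℤ) : Expr
  | read (a : ℕ) (i j : Expr) : Expr
  | add (e₁ e₂ : Expr) : Expr
  | sub (e₁ e₂ : Expr) : Expr
  | mul (e₁ e₂ : Expr) : Expr

namespace Expr

/-- Value of an expression. -/
def eval (σ : Mem) : Expr → ℤ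
  | const c => c
  | read a i j => σ a (i.eval σ) (j.eval σ)
  | add e₁ e₂ => e₁.eval σ + e₂.eval σ
  | sub e₁ e₂ => e₁.eval σ - e₂.eval σ
  | mul e₁ e₂ => e₁.eval σ * e₂.eval σ

/-- Number of elementary operations needed to evaluate an expression. -/
def cost : Expr → ℕ
  | const _ => 1
  | read _ i j => i.cost + j.cost + 1
  | add e₁ e₂ => e₁.cost + e₂.cost + 1
  | sub e₁ e₂ => e₁.cost + e₂.cost + 1
  | mul e₁ e₂ => e₁.cost + e₂.cost + 1

end Expr

/-- Encoding length of an integer: a sign bit and the binary digits of the absolute value. -/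
def bitLength (z : ℤ) : ℕ := Nat.size z.natAbs + 1

/-- Every number that occurs in the evaluation of the expression, addresses included, has encoding
length at most `s`. -/
def Expr.Fits (s : ℕ) (σ : Mem) : Expr → Prop
  | .const c => bitLength c ≤ s
  | .read a i j =>
      i.Fits s σ ∧ j.Fits s σ ∧ bitLength ((Expr.read a i j).eval σ) ≤ s
  | .add e₁ e₂ =>
      e₁.Fits s σ ∧ e₂.Fits s σ ∧ bitLength ((Expr.add e₁ e₂).eval σ) ≤ s
  | .sub e₁ e₂ =>
      e₁.Fits s σ ∧ e₂.Fits s σ ∧ bitLength ((Expr.sub e₁ e₂).eval σ) ≤ s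
  | .mul e₁ e₂ =>
      e₁.Fits s σ ∧ e₂.Fits s σ ∧ bitLength ((Expr.mul e₁ e₂).eval σ) ≤ s

/-- Programs. -/
inductive Prog : Type
  | skip : Prog
  /-- `a[i, j] := e` -/
  | store (a : ℕ) (i j e : Expr) : Prog
  | seq (P Q : Prog) : Prog
  /-- `if e₁ ≤ e₂ then P else Q` -/
  | ite (e₁ e₂ : Expr) (P Q : Prog) : Prog
  /-- `while e₁ ≤ e₂ do P` -/
  | loop (e₁ e₂ : Expr) (P : Prog) : Prog

/-- `Exec s P σ t σ'`: the program `P`, started with memory `σ`, halts with memory `σ'` after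
exactly `t` elementary steps, and all numbers that occur during the computation have encoding
length at most `s`. -/
inductive Exec (s : ℕ) : Prog → Mem → ℕ → Mem → Prop
  | skip (σ : Mem) : Exec s .skip σ 1 σ
  | store (a : ℕ) (i j e : Expr) (σ : Mem) :
      i.Fits s σ → j.Fits s σ → e.Fits s σ →
      Exec s (.store a i j e) σ (i.cost + j.cost + e.cost + 1)
        (σ.write a (i.eval σ) (j.eval σ) (e.eval σ))
  | seq (P Q : Prog) (σ σ' σ'' : Mem) (t t' : ℕ) :
      Exec s P σ t σ' → Exec s Q σ' t' σ'' → Exec s (.seq P Q) σ (t + t') σ''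
  | ite_true (e₁ e₂ : Expr) (P Q : Prog) (σ σ' : Mem) (t : ℕ) :
      e₁.Fits s σ → e₂.Fits s σ → e₁.eval σ ≤ e₂.eval σ → Exec s P σ t σ' →
      Exec s (.ite e₁ e₂ P Q) σ (e₁.cost + e₂.cost + 1 + t) σ'
  | ite_false (e₁ e₂ : Expr) (P Q : Prog) (σ σ' : Mem) (t : ℕ) :
      e₁.Fits s σ → e₂.Fits s σ → ¬ e₁.eval σ ≤ e₂.eval σ → Exec s Q σ t σ' →
      Exec s (.ite e₁ e₂ P Q) σ (e₁.cost + e₂.cost + 1 + t) σ'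
  | loop_true (e₁ e₂ : Expr) (P : Prog) (σ σ' σ'' : Mem) (t t' : ℕ) :
      e₁.Fits s σ → e₂.Fits s σ → e₁.eval σ ≤ e₂.eval σ → Exec s P σ t σ' →
      Exec s (.loop e₁ e₂ P) σ' t' σ'' →
      Exec s (.loop e₁ e₂ P) σ (e₁.cost + e₂.cost + 1 + t + t') σ''
  | loop_false (e₁ e₂ : Expr) (P : Prog) (σ : Mem) :
      e₁.Fits s σ → e₂.Fits s σ → ¬ e₁.eval σ ≤ e₂.eval σ →
      Exec s (.loop e₁ e₂ P) σ (e₁.cost + e₂.cost + 1) σ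

/-! ### Input format -/

/-- The array with the entries of `A` in the cells `(i, j)`, `0 ≤ i < k`, `0 ≤ j < n`, and `0` in
all other cells. -/
def arrayOf {k n : ℕ} (A : Matrix (Fin k) (Fin n) ℤ) : ℤ → ℤ → ℤ
  | .ofNat i, .ofNat j => if h : i < k ∧ j < n then A ⟨i, h.1⟩ ⟨j, h.2⟩ else 0
  | _, _ => 0

/-- The initial memory: arrays `0, …, 5` hold `k`, `n`, `T`, `b`, `x₀`, `y` (scalars in cell
`(0, 0)`, vectors in column `0`); all other cells are `0`. -/
def inputMem {k n : ℕ} (T : Matrix (Fin k) (Fin n) ℤ) (b : Fin k → ℤ) (x₀ y : Fin n → ℤ) : Mem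
  | 0 => arrayOf (Matrix.replicateCol (Fin 1) fun _ : Fin 1 => (k : ℤ))
  | 1 => arrayOf (Matrix.replicateCol (Fin 1) fun _ : Fin 1 => (n : ℤ))
  | 2 => arrayOf T
  | 3 => arrayOf (Matrix.replicateCol (Fin 1) b)
  | 4 => arrayOf (Matrix.replicateCol (Fin 1) x₀)
  | 5 => arrayOf (Matrix.replicateCol (Fin 1) y)
  | _ => fun _ _ => 0

/-- The number of integers in the input `(k, n, T, b, x₀, y)`. -/
def inputCount (k n : ℕ) : ℕ := 2 + k * n + k + n + n

/-- The total encoding length of the input `(k, n, T, b, x₀, y)`. -/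
def inputLength {k n : ℕ} (T : Matrix (Fin k) (Fin n) ℤ) (b : Fin k → ℤ) (x₀ y : Fin n → ℤ) : ℕ :=
  bitLength k + bitLength n + (∑ i, ∑ j, bitLength (T i j)) + (∑ i, bitLength (b i)) +
    (∑ j, bitLength (x₀ j)) + ∑ j, bitLength (y j)

/-!
Write `M` for `T` stacked below the unit matrix. A nonsingular choice of `n` rows of `M` gives a
tableau `N = M B`, `B` being the inverse of the chosen submatrix. By Cramer's rule the entries of
`N` lie in `{-1, 0, 1}`, and the columns of `B` are elementary because the same rule applies to `T`
with a TU-appendable row added.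

To split a column off `u = M z`, eliminate the basis entries of a copy `w` of `u` one by one,
pivoting each time on the row where `|w|` is smallest on the support of the column; the ratio test
keeps every entry of `w` between `0` and that of `u`. What is left is a multiple of one column,
conformal to `u`. Subtracting from `u` the largest multiple of this column that keeps the rest
conformal creates a further zero of `u` on a basis row, so after `n` rounds nothing is left. Since
all the terms are conformal to `M (y - x₀)`, partial sums of them stay between `0` and `T (y - x₀)`
on the rows of `T`.

Conformality bounds the current vector on the basis by its initial size throughout, hence all of it
by `n` times as much, so the numbers never grow; a program whose expressions have bounded width only
ever evaluates bounded powers of these.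
-/

/-! ### Tableaux and pivot steps -/

section Pivot

variable {ι κ α : Type*} [CommRing α]

/-- The tableau after row `i` has been exchanged for the `c`-th basis row. The pivot `N i c`, being
`±1` in all applications, serves as its own inverse. -/
def pivotMat [DecidableEq κ] (N : Matrix ι κ α) (c : κ) (i : ι) : Matrix ι κ α :=
  N - vecMulVec (N.col c) (N i c • (N i - Pi.single c 1))

/-- `w` minus the multiple of column `c` of the tableau that makes its entry `i` vanish, for a
pivot `N i c = ±1`. -/
def pivotVec (N : Matrix ι κ α) (c : κ) (i : ι) (w : ι → α) : ι → α :=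
  w - (N i c * w i) • N.col c

theorem pivotMat_apply [DecidableEq κ] (N : Matrix ι κ α) (c : κ) (i j : ι) (a : κ) :
    pivotMat N c i j a = N j a - N j c * (N i c * (N i a - if a = c then 1 else 0)) := by
  rw [← Pi.single_apply]
  rfl

theorem pivotVec_apply (N : Matrix ι κ α) (c : κ) (i j : ι) (w : ι → α) :
    pivotVec N c i w j = w j - N i c * w i * N j c := rfl

theorem pivotVec_self {N : Matrix ι κ α} {c : κ} {i : ι} (w : ι → α) (hi : N i c * N i c = 1) :
    pivotVec N c i w i = 0 := by
  rw [pivotVec_apply]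
  linear_combination (-w i) * hi

end Pivot

section Tableau

variable {ι κ α : Type*} [Fintype κ] [DecidableEq κ] [CommRing α]
  {M N : Matrix ι κ α} {R : κ → ι} {w : ι → α} {c : κ} {i : ι}

/-- `N` expresses every row of `M` in the basis formed by the rows `R` of `M`. -/
def IsTableau (M : Matrix ι κ α) (R : κ → ι) (N : Matrix ι κ α) : Prop :=
  ∃ B : Matrix κ κ α, M.submatrix R id * B = 1 ∧ M * B = N

namespace IsTableau

theorem apply_basis (h : IsTableau M R N) (a b : κ) : N (R a) b = if a = b then 1 else 0 := by
  obtain ⟨B, hB, rfl⟩ := h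
  rw [← Matrix.one_apply, ← hB]
  rfl

theorem exists_ne_zero [Nontrivial α] (h : IsTableau M R N) (c : κ) : ∃ i, N i c ≠ 0 :=
  ⟨R c, by simp [h.apply_basis]⟩

theorem col_mem_range (h : IsTableau M R N) (c : κ) : N.col c ∈ LinearMap.range M.mulVecLin := by
  obtain ⟨B, -, rfl⟩ := h
  exact ⟨B.col c, rfl⟩

theorem mulVec_comp (h : IsTableau M R N) (hw : w ∈ LinearMap.range M.mulVecLin) :
    N *ᵥ (w ∘ R) = w := by
  obtain ⟨B, hB, rfl⟩ := h
  obtain ⟨v, rfl⟩ := hw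
  have hbasis : M.mulVecLin v ∘ R = M.submatrix R id *ᵥ v := rfl
  rw [hbasis, mulVec_mulVec, Matrix.mul_assoc, mul_eq_one_comm.mp hB, Matrix.mul_one,
    mulVecLin_apply]

theorem pivotVec_mem_range (h : IsTableau M R N) (c : κ) (i : ι)
    (hw : w ∈ LinearMap.range M.mulVecLin) : pivotVec N c i w ∈ LinearMap.range M.mulVecLin :=
  sub_mem hw (Submodule.smul_mem _ _ (h.col_mem_range c))

theorem pivotVec_of_ne (h : IsTableau M R N) {a c : κ} (hac : a ≠ c) (i : ι) (w : ι → α) :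
    pivotVec N c i w (R a) = w (R a) := by
  simp [pivotVec_apply, h.apply_basis, hac]

theorem pivotVec_update_of_ne (h : IsTableau M R N) {a : κ} (hac : a ≠ c) (i : ι) (w : ι → α) :
    pivotVec N c i w (Function.update R c i a) = w (R a) := by
  rw [Function.update_of_ne hac, h.pivotVec_of_ne hac]

theorem pivot (h : IsTableau M R N) (hi : N i c * N i c = 1) :
    IsTableau M (Function.update R c i) (pivotMat N c i) := by
  have hbasis := h.apply_basis
  obtain ⟨B, -, rfl⟩ := h
  set N := M * B with hN
  -- The column operations of the pivot step form a single elementary matrix.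
  let E : Matrix κ κ α := 1 - vecMulVec (Pi.single c 1) (N i c • (N i - Pi.single c 1))
  have hE : N * E = pivotMat N c i := by
    rw [Matrix.mul_sub, Matrix.mul_one, mul_vecMulVec, mulVec_single_one, pivotMat]
  refine ⟨B * E, ?_, by rw [← Matrix.mul_assoc, ← hN, hE]⟩
  have hrows : M.submatrix (Function.update R c i) id * (B * E) =
      (pivotMat N c i).submatrix (Function.update R c i) id := by
    rw [← hE, hN, Matrix.mul_assoc]
    rfl
  rw [hrows]
  ext a b
  rw [submatrix_apply, Matrix.one_apply, pivotMat_apply, id]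
  obtain rfl | hac := eq_or_ne a c
  · rw [Function.update_self, ← mul_assoc, hi, one_mul, sub_sub_cancel]
    simp only [eq_comm]
  · rw [Function.update_of_ne hac, hbasis a b, hbasis a c, if_neg hac, zero_mul, sub_zero]

end IsTableau

end Tableau

theorem mul_self_eq_one_of_abs_le_one {x : ℤ} (hx : |x| ≤ 1) (h0 : x ≠ 0) : x * x = 1 :=
  Int.isUnit_mul_self (Int.isUnit_iff_abs_eq.mpr (le_antisymm hx (Int.one_le_abs h0)))

theorem abs_sum_mul_le_card_mul {κ : Type*} [Fintype κ] {x z : κ → ℤ} {U : ℤ} (s : Finset κ)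
    (hx : ∀ a, |x a| ≤ 1) (hz : ∀ a, |z a| ≤ U) : |∑ a ∈ s, x a * z a| ≤ Fintype.card κ * U :=
  calc |∑ a ∈ s, x a * z a| ≤ ∑ a ∈ s, |x a * z a| := Finset.abs_sum_le_sum_abs _ _
    _ ≤ ∑ a, |x a * z a| := Finset.sum_le_univ_sum_of_nonneg fun _ => abs_nonneg _
    _ ≤ ∑ _a : κ, U := Finset.sum_le_sum fun a _ => by
        rw [abs_mul]
        exact (mul_le_of_le_one_left (abs_nonneg _) (hx a)).trans (hz a)
    _ = Fintype.card κ * U := by simp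

/-! ### Conformal vectors and ratio rows -/

/-- `x` has the sign of `y`, or is zero. -/
def SignConform (x y : ℤ) : Prop := (0 ≤ y → 0 ≤ x) ∧ (y ≤ 0 → x ≤ 0)

namespace SignConform

theorem refl (x : ℤ) : SignConform x x := ⟨id, id⟩

theorem trans {x y z : ℤ} (h : SignConform x y) (h' : SignConform y z) : SignConform x z :=
  ⟨fun hz => h.1 (h'.1 hz), fun hz => h.2 (h'.2 hz)⟩

theorem mul_left {x y : ℤ} (h : SignConform x y) (a : ℤ) : SignConform (a * x) (a * y) := by
  obtain ha | rfl | ha := lt_trichotomy a 0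
  · simpa [SignConform, mul_nonneg_iff, mul_nonpos_iff, ha.le, ha.not_ge] using h.symm
  · simp only [zero_mul, refl]
  · simpa [SignConform, mul_nonneg_iff, mul_nonpos_iff, ha.le, ha.not_ge] using h

theorem abs_le_abs_add {x y : ℤ} (hx : SignConform x (x + y)) (hy : SignConform y (x + y)) :
    |x| ≤ |x + y| := by
  obtain h | h := le_total 0 (x + y)
  · rw [abs_of_nonneg h, abs_of_nonneg (hx.1 h)]
    exact le_add_of_nonneg_right (hy.1 h)
  · rw [abs_of_nonpos h, abs_of_nonpos (hx.2 h)]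
    exact neg_le_neg (add_le_of_nonpos_right (hy.2 h))

end SignConform

/-- The ratio test: `|w i|` is least among the `|w j|` of the rows `j` that meet column `c`. -/
def IsRatioRow {ι κ : Type*} (N : Matrix ι κ ℤ) (w : ι → ℤ) (c : κ) (i : ι) : Prop :=
  N i c ≠ 0 ∧ ∀ j, N j c ≠ 0 → |w i| ≤ |w j|

theorem IsRatioRow.signConform_pivotVec {ι κ : Type*} {N : Matrix ι κ ℤ} {w : ι → ℤ} {c : κ}
    {i : ι} (hi : IsRatioRow N w c i) (hN : ∀ j, |N j c| ≤ 1) (j : ι) :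
    SignConform (pivotVec N c i w j) (w j) := by
  rw [pivotVec_apply]
  by_cases hj : N j c = 0
  · rw [hj, mul_zero, sub_zero]
    exact .refl _
  have hle : |N i c * w i * N j c| ≤ |w j| := by
    rw [abs_mul, abs_mul]
    calc |N i c| * |w i| * |N j c| ≤ 1 * |w i| * 1 := by gcongr <;> exact hN _
      _ ≤ |w j| := by simpa using hi.2 j hj
  exact ⟨fun h => sub_nonneg.mpr ((le_abs_self _).trans (hle.trans_eq (abs_of_nonneg h))),
    fun h => sub_nonpos.mpr
      (neg_le_neg_iff.mp (by linarith [neg_abs_le (N i c * w i * N j c), abs_of_nonpos h]))⟩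

/-! ### Reduction of a vector to zero -/

section Reduction

variable {ι κ : Type*} [Fintype κ] [DecidableEq κ] {M N : Matrix ι κ ℤ} {R : κ → ι}
  {U : ℤ} {S D : Finset κ} {p c : κ} {u w : ι → ℤ} {i : ι}

/-- By Cramer's rule the entries are, up to sign, minors of `M`. -/
theorem abs_mul_apply_le_one (hM : M.IsTotallyUnimodular) {B : Matrix κ κ ℤ}
    (hB : M.submatrix R id * B = 1) (j : ι) (c : κ) : |(M * B) j c| ≤ 1 := by
  have hrow : M.submatrix (Function.update R c j) id = (M.submatrix R id).updateRow c (M j) := by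
    ext a b
    obtain rfl | hac := eq_or_ne a c <;> simp [*]
  have hdet : (M.submatrix (Function.update R c j) id).det * B.det = (M * B) j c := by
    rw [← det_mul, hrow, updateRow_mul, hB, ← det_transpose, ← updateCol_transpose, transpose_one,
      ← cramer_apply, cramer_one]
    rfl
  have hunit : |B.det| = 1 :=
    Int.isUnit_iff_abs_eq.mp
      (IsUnit.of_mul_eq_one_right _ (by rw [← det_mul, hB, det_one]))
  rw [← hdet, abs_mul, hunit, mul_one, Int.abs_le_one_iff]
  obtain ⟨s, hs⟩ := (isTotallyUnimodular_iff_fintype M).mp hM κ (Function.update R c j) id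
  rw [← hs]
  cases s <;> simp

theorem IsTableau.abs_apply_le_one (h : IsTableau M R N) (hM : M.IsTotallyUnimodular) (j : ι)
    (c : κ) : |N j c| ≤ 1 := by
  obtain ⟨B, hB, rfl⟩ := h
  exact abs_mul_apply_le_one hM hB j c

theorem IsTableau.mul_self_eq_one (h : IsTableau M R N) (hM : M.IsTotallyUnimodular)
    (hi : N i c ≠ 0) : N i c * N i c = 1 :=
  mul_self_eq_one_of_abs_le_one (h.abs_apply_le_one hM i c) hi

theorem IsTableau.abs_le_card_mul (h : IsTableau M R N) (hM : M.IsTotallyUnimodular)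
    (hw : w ∈ LinearMap.range M.mulVecLin) (hU : ∀ a, |w (R a)| ≤ U) (j : ι) :
    |w j| ≤ Fintype.card κ * U := by
  rw [← congrFun (h.mulVec_comp hw) j]
  exact abs_sum_mul_le_card_mul _ (h.abs_apply_le_one hM j) hU

/-- The reduction after the rounds for the columns in `S`: the remainder `u` vanishes on the basis
rows of these columns. -/
structure Reduced (M : Matrix ι κ ℤ) (U : ℤ) (S : Finset κ) (R : κ → ι) (N : Matrix ι κ ℤ)
    (u : ι → ℤ) : Prop where
  tableau : IsTableau M R N
  mem_range : u ∈ LinearMap.range M.mulVecLin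
  eq_zero_of_mem : ∀ a ∈ S, u (R a) = 0
  abs_le : ∀ j, |u j| ≤ U

/-- The round for column `p`, once the columns in `D` have been treated: `w` is conformal to the
remainder `u` and is being reduced to a multiple of column `p`. -/
structure RoundReduced (M : Matrix ι κ ℤ) (U : ℤ) (S : Finset κ) (p : κ) (u : ι → ℤ) (D : Finset κ)
    (R : κ → ι) (N : Matrix ι κ ℤ) (w : ι → ℤ) : Prop where
  reduced : Reduced M U S R N u
  mem_range : w ∈ LinearMap.range M.mulVecLin
  conform : ∀ j, SignConform (w j) (u j)
  apply_eq : w (R p) = u (R p)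
  eq_zero_of_mem : ∀ a ∈ D, a ≠ p → w (R a) = 0
  abs_basis_le : ∀ a, |w (R a)| ≤ U

theorem Reduced.eq_zero (h : Reduced M U Finset.univ R N u) : u = 0 := by
  have hbasis : u ∘ R = 0 := funext fun a => h.eq_zero_of_mem a (Finset.mem_univ a)
  rw [← h.tableau.mulVec_comp h.mem_range, hbasis, mulVec_zero]

theorem Reduced.startRound (h : Reduced M U S R N u) (p : κ) :
    RoundReduced M U S p u (insert p S) R N u where
  reduced := h
  mem_range := h.mem_range
  conform _ := .refl _
  apply_eq := rfl
  eq_zero_of_mem a ha hap := h.eq_zero_of_mem a (Finset.mem_of_mem_insert_of_ne ha hap)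
  abs_basis_le _ := h.abs_le _

theorem RoundReduced.pivot (h : RoundReduced M U S p u D R N w) (hM : M.IsTotallyUnimodular)
    (hcS : c ∉ S) (hcp : c ≠ p) (hi : IsRatioRow N w c i) :
    RoundReduced M U S p u (insert c D) (Function.update R c i) (pivotMat N c i)
      (pivotVec N c i w) := by
  have htab := h.reduced.tableau
  have hpiv := htab.mul_self_eq_one hM hi.1
  have hc : pivotVec N c i w (Function.update R c i c) = 0 := by
    rw [Function.update_self, pivotVec_self w hpiv]
  refine ⟨⟨htab.pivot hpiv, h.reduced.mem_range, fun a ha => ?_, h.reduced.abs_le⟩,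
    htab.pivotVec_mem_range c i h.mem_range, fun j => ?_, ?_, fun a ha hap => ?_, fun a => ?_⟩
  · rw [Function.update_of_ne (ne_of_mem_of_not_mem ha hcS), h.reduced.eq_zero_of_mem a ha]
  · exact (hi.signConform_pivotVec (fun j => htab.abs_apply_le_one hM j c) j).trans (h.conform j)
  · rw [htab.pivotVec_update_of_ne hcp.symm, Function.update_of_ne hcp.symm, h.apply_eq]
  · obtain rfl | hac := eq_or_ne a c
    · exact hc
    · rw [htab.pivotVec_update_of_ne hac]
      exact h.eq_zero_of_mem a (Finset.mem_of_mem_insert_of_ne ha hac) hap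
  · obtain rfl | hac := eq_or_ne a c
    · rw [hc, abs_zero]
      exact (abs_nonneg _).trans (h.abs_basis_le a)
    · rw [htab.pivotVec_update_of_ne hac]
      exact h.abs_basis_le a

theorem RoundReduced.signConform_col (h : RoundReduced M U S p u Finset.univ R N w) (j : ι) :
    SignConform (N j p * u (R p)) (u j) := by
  have hw : w j = N j p * w (R p) := by
    conv_lhs => rw [← h.reduced.tableau.mulVec_comp h.mem_range]
    exact Finset.sum_eq_single p
      (fun a _ ha => by simp [h.eq_zero_of_mem a (Finset.mem_univ a) ha]) (by simp)
  rw [← h.apply_eq, ← hw]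
  exact h.conform j

theorem Reduced.signConform_pivotTerm (h : Reduced M U S R N u) (hM : M.IsTotallyUnimodular)
    (hconf : ∀ j, SignConform (N j p * u (R p)) (u j)) (hi : IsRatioRow N u p i) (j : ι) :
    SignConform (N i p * u i * N j p) (u j) := by
  have hpiv := h.tableau.mul_self_eq_one hM hi.1
  have hle : |u i| ≤ |u (R p)| := hi.2 (R p) (by simp [h.tableau.apply_basis])
  have hbasis : SignConform (N i p * u i) (u (R p)) := by
    have hconf_i := hconf i
    unfold SignConform at hconf_i ⊢
    rcases Int.eq_one_or_neg_one_of_mul_eq_one hpiv with hN | hN <;> rw [hN] at hconf_i ⊢ <;>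
      rcases abs_cases (u i) with hu | hu <;> rcases abs_cases (u (R p)) with hx | hx <;> omega
  rw [mul_comm]
  exact (hbasis.mul_left (N j p)).trans (hconf j)

theorem Reduced.pivot (h : Reduced M U S R N u) (hM : M.IsTotallyUnimodular)
    (hconf : ∀ j, SignConform (N j p * u (R p)) (u j)) (hi : IsRatioRow N u p i) :
    Reduced M U (insert p S) (Function.update R p i) (pivotMat N p i) (pivotVec N p i u) := by
  have hpiv := h.tableau.mul_self_eq_one hM hi.1
  refine ⟨h.tableau.pivot hpiv, h.tableau.pivotVec_mem_range p i h.mem_range, fun a ha => ?_,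
    fun j => ?_⟩
  · obtain rfl | hap := eq_or_ne a p
    · rw [Function.update_self, pivotVec_self u hpiv]
    · rw [h.tableau.pivotVec_update_of_ne hap]
      exact h.eq_zero_of_mem a (Finset.mem_of_mem_insert_of_ne ha hap)
  · have hsplit : pivotVec N p i u j + N i p * u i * N j p = u j := sub_add_cancel _ _
    have hrest := hi.signConform_pivotVec (fun j => h.tableau.abs_apply_le_one hM j p) j
    have hterm := h.signConform_pivotTerm hM hconf hi j
    rw [← hsplit] at hrest hterm
    exact (hrest.abs_le_abs_add hterm).trans (hsplit ▸ h.abs_le j)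

end Reduction

theorem mul_le_max_zero_mul {lam mu z : ℤ} (hmu : 0 ≤ mu) (hle : mu ≤ lam) :
    mu * z ≤ max 0 (lam * z) := by
  obtain hz | hz := le_total 0 z
  · exact le_max_of_le_right (mul_le_mul_of_nonneg_right hle hz)
  · exact le_max_of_le_left (mul_nonpos_of_nonneg_of_nonpos hmu hz)

theorem sum_mul_le_max_of_signConform {ι : Type*} {s : Finset ι} {lam mu z : ι → ℤ} {x : ℤ}
    (hsum : x = ∑ i ∈ s, lam i * z i) (hconf : ∀ i ∈ s, SignConform (lam i * z i) x)
    (hmu : ∀ i, 0 ≤ mu i ∧ mu i ≤ lam i) : ∑ i ∈ s, mu i * z i ≤ max 0 x := by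
  have hle : ∀ i ∈ s, mu i * z i ≤ max 0 (lam i * z i) := fun i _ =>
    mul_le_max_zero_mul (hmu i).1 (hmu i).2
  refine (Finset.sum_le_sum hle).trans ?_
  obtain hx | hx := le_total 0 x
  · rw [Finset.sum_congr rfl fun i hi => max_eq_right ((hconf i hi).1 hx), ← hsum]
    exact le_max_right _ _
  · rw [Finset.sum_eq_zero fun i hi => max_eq_left ((hconf i hi).2 hx)]
    exact le_max_left _ _

/-! ### Elementary vectors and conformal decompositions -/

section System

variable {k n : ℕ} {T : Matrix (Fin k) (Fin n) ℤ} {x d : Fin n → ℤ} {b : Fin k → ℤ}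

/-- The matrix `T` below the unit rows. Its values `stacked T *ᵥ x` record `x` along with `T x`, and
the unit rows form an initial basis. -/
def stacked (T : Matrix (Fin k) (Fin n) ℤ) : Matrix (Fin n ⊕ Fin k) (Fin n) ℤ :=
  fromRows 1 T

@[simp]
theorem stacked_mulVec_inl (T : Matrix (Fin k) (Fin n) ℤ) (x : Fin n → ℤ) (j : Fin n) :
    (stacked T *ᵥ x) (.inl j) = x j := by
  simp [stacked]

@[simp]
theorem stacked_mulVec_inr (T : Matrix (Fin k) (Fin n) ℤ) (x : Fin n → ℤ) (i : Fin k) :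
    (stacked T *ᵥ x) (.inr i) = (T *ᵥ x) i := by
  simp [stacked]

theorem isTableau_stacked (T : Matrix (Fin k) (Fin n) ℤ) :
    IsTableau (stacked T) Sum.inl (stacked T) :=
  ⟨1, by rw [Matrix.mul_one]; rfl, Matrix.mul_one _⟩

theorem isTotallyUnimodular_stacked (hT : T.IsTotallyUnimodular) :
    (stacked T).IsTotallyUnimodular :=
  hT.one_fromRows

theorem TUAppendable.stacked_fromRows (hd : TUAppendable T d) :
    (fromRows (stacked T) (replicateRow (Fin 1) d)).IsTotallyUnimodular := by
  convert hd.one_fromRows.submatrix (Equiv.sumAssoc (Fin n) (Fin k) (Fin 1)) id using 1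
  ext ((a | a) | a) j <;> rfl

theorem isElementary_iff : IsElementary T x ↔ ∀ d, TUAppendable T d → |d ⬝ᵥ x| ≤ 1 := by
  simp only [IsElementary, Set.mem_insert_iff, Set.mem_singleton_iff, Int.abs_le_one_iff]
  grind

theorem IsElementary.smul (hx : IsElementary T x) {z : ℤ} (hz : |z| ≤ 1) :
    IsElementary T (z • x) :=
  isElementary_iff.mpr fun d hd => by
    rw [dotProduct_smul, smul_eq_mul, abs_mul]
    exact mul_le_one₀ hz (abs_nonneg _) (isElementary_iff.mp hx d hd)

section Column

variable {R : Fin n → Fin n ⊕ Fin k} {N : Matrix (Fin n ⊕ Fin k) (Fin n) ℤ}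

theorem IsTableau.stacked_mulVec_col (h : IsTableau (stacked T) R N) (c : Fin n) :
    (stacked T *ᵥ fun j => N (.inl j) c) = N.col c := by
  obtain ⟨x, hx⟩ := h.col_mem_range c
  rw [← hx]
  exact congrArg _ (funext fun j => by rw [← stacked_mulVec_inl T x j, ← mulVecLin_apply, hx]; rfl)

/-- On the unit rows the columns of a tableau are those of the inverse of the basis. -/
theorem IsTableau.isElementary_col (h : IsTableau (stacked T) R N) (c : Fin n) :
    IsElementary T fun j => N (.inl j) c := by
  obtain ⟨B, hB, rfl⟩ := h
  have hcol : (fun j => (stacked T * B) (.inl j) c) = B.col c :=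
    funext fun j => stacked_mulVec_inl T (B.col c) j
  rw [hcol]
  exact isElementary_iff.mpr fun d hd =>
    abs_mul_apply_le_one hd.stacked_fromRows (R := Sum.inl ∘ R) hB (.inr 0) c

end Column

/-- What remains of `u₀` after the terms `lam q • (stacked T *ᵥ Y q)`, `q ∈ S`, have been split off
conformally is `u`. -/
structure PartialDecomposition (T : Matrix (Fin k) (Fin n) ℤ) (u₀ : Fin n ⊕ Fin k → ℤ)
    (S : Finset (Fin n)) (lam : Fin n → ℤ) (Y : Fin n → Fin n → ℤ) (u : Fin n ⊕ Fin k → ℤ) :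
    Prop where
  eq_add_sum : u₀ = u + ∑ q ∈ S, lam q • (stacked T *ᵥ Y q)
  conform : ∀ j, SignConform (u j) (u₀ j)
  nonneg : ∀ q ∈ S, 0 ≤ lam q
  elementary : ∀ q ∈ S, IsElementary T (Y q)
  term_conform : ∀ q ∈ S, ∀ j, SignConform (lam q * (stacked T *ᵥ Y q) j) (u₀ j)

namespace PartialDecomposition

variable {u₀ u u' : Fin n ⊕ Fin k → ℤ} {S : Finset (Fin n)} {lam : Fin n → ℤ}
  {Y : Fin n → Fin n → ℤ}

theorem empty (T : Matrix (Fin k) (Fin n) ℤ) (u₀ : Fin n ⊕ Fin k → ℤ) (lam : Fin n → ℤ)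
    (Y : Fin n → Fin n → ℤ) : PartialDecomposition T u₀ ∅ lam Y u₀ where
  eq_add_sum := by simp
  conform _ := .refl _
  nonneg := by simp
  elementary := by simp
  term_conform := by simp

theorem congr (h : PartialDecomposition T u₀ S lam Y u) {lam' : Fin n → ℤ} {Y' : Fin n → Fin n → ℤ}
    (hlam : ∀ q ∈ S, lam' q = lam q) (hY : ∀ q ∈ S, Y' q = Y q) :
    PartialDecomposition T u₀ S lam' Y' u where
  eq_add_sum := by
    rw [Finset.sum_congr rfl fun q hq => by rw [hlam q hq, hY q hq]]
    exact h.eq_add_sum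
  conform := h.conform
  nonneg q hq := by rw [hlam q hq]; exact h.nonneg q hq
  elementary q hq := by rw [hY q hq]; exact h.elementary q hq
  term_conform q hq := by rw [hlam q hq, hY q hq]; exact h.term_conform q hq

theorem insert_term (h : PartialDecomposition T u₀ S lam Y u) {p : Fin n} (hp : p ∉ S)
    (hsplit : u = u' + lam p • (stacked T *ᵥ Y p))
    (hconf : ∀ j, SignConform (u' j) (u j)) (hlam : 0 ≤ lam p) (hY : IsElementary T (Y p))
    (hterm : ∀ j, SignConform (lam p * (stacked T *ᵥ Y p) j) (u j)) :
    PartialDecomposition T u₀ (insert p S) lam Y u' where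
  eq_add_sum := by rw [Finset.sum_insert hp, ← add_assoc, ← hsplit, h.eq_add_sum]
  conform j := (hconf j).trans (h.conform j)
  nonneg := Finset.forall_mem_insert _ _ _ |>.mpr ⟨hlam, h.nonneg⟩
  elementary := Finset.forall_mem_insert _ _ _ |>.mpr ⟨hY, h.elementary⟩
  term_conform := Finset.forall_mem_insert _ _ _ |>.mpr
    ⟨fun j => (hterm j).trans (h.conform j), h.term_conform⟩

theorem pivot (h : PartialDecomposition T u₀ S lam Y u) {R : Fin n → Fin n ⊕ Fin k}
    {N : Matrix (Fin n ⊕ Fin k) (Fin n) ℤ} {U : ℤ} {p : Fin n} {i : Fin n ⊕ Fin k} {g : ℤ}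
    (hT : T.IsTotallyUnimodular) (hred : Reduced (stacked T) U S R N u) (hp : p ∉ S)
    (hconf : ∀ j, SignConform (N j p * u (R p)) (u j)) (hi : IsRatioRow N u p i)
    (hg : |g| = 1) (hlam : lam p = g * (N i p * u i)) (hlam_nonneg : 0 ≤ lam p)
    (hY : Y p = g • fun j => N (.inl j) p) :
    PartialDecomposition T u₀ (insert p S) lam Y (pivotVec N p i u) := by
  have hunit : g * g = 1 := Int.isUnit_mul_self (Int.isUnit_iff_abs_eq.mpr hg)
  have hM := isTotallyUnimodular_stacked hT
  have hterm : ∀ j, lam p * (stacked T *ᵥ Y p) j = N i p * u i * N j p := fun j => by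
    rw [hlam, hY, mulVec_smul, hred.tableau.stacked_mulVec_col, Pi.smul_apply, smul_eq_mul,
      col_apply]
    linear_combination (N i p * u i * N j p) * hunit
  refine h.insert_term hp (funext fun j => ?_)
    (hi.signConform_pivotVec fun j => hred.tableau.abs_apply_le_one hM j p) hlam_nonneg
    (hY ▸ (hred.tableau.isElementary_col p).smul hg.le) fun j => ?_
  · rw [Pi.add_apply, Pi.smul_apply, smul_eq_mul, hterm, pivotVec_apply, sub_add_cancel]
  · rw [hterm]
    exact hred.signConform_pivotTerm hM hconf hi j

/-- On the rows of `T`, a partial sum of conformal terms lies between `0` and the total, so that it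
violates no constraint that holds at both `x₀` and `y`. -/
theorem isDecomposition {x₀ y : Fin n → ℤ}
    (h : PartialDecomposition T (stacked T *ᵥ (y - x₀)) Finset.univ lam Y 0)
    (hx : T *ᵥ x₀ ≤ b) (hy : T *ᵥ y ≤ b) : IsDecomposition T b x₀ y lam Y where
  nonneg i := h.nonneg i (Finset.mem_univ i)
  sum_eq := by
    ext j
    simpa using congrFun h.eq_add_sum (.inl j)
  elementary i := h.elementary i (Finset.mem_univ i)
  feasible mu hmu i := by
    have hsum : (T *ᵥ (y - x₀)) i = ∑ q, lam q * (T *ᵥ Y q) i := by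
      simpa using congrFun h.eq_add_sum (.inr i)
    have hterm : ∀ q ∈ Finset.univ, SignConform (lam q * (T *ᵥ Y q) i) ((T *ᵥ (y - x₀)) i) :=
      fun q hq => by simpa using h.term_conform q hq (.inr i)
    calc (T *ᵥ (x₀ + ∑ q, mu q • Y q)) i = (T *ᵥ x₀) i + ∑ q, mu q * (T *ᵥ Y q) i := by
          simp only [mulVec_add, mulVec_sum, mulVec_smul, Pi.add_apply, Finset.sum_apply,
            Pi.smul_apply, smul_eq_mul]
      _ ≤ (T *ᵥ x₀) i + max 0 ((T *ᵥ (y - x₀)) i) := by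
          gcongr
          exact sum_mul_le_max_of_signConform hsum hterm hmu
      _ = max ((T *ᵥ x₀) i) ((T *ᵥ y) i) := by
          rw [mulVec_sub, Pi.sub_apply, ← max_add_add_left, add_zero,
            add_sub_cancel]
      _ ≤ b i := max_le (hx i) (hy i)

end PartialDecomposition

end System

/-! ### Program logic -/

namespace Mem

theorem write_same (σ : Mem) (a : ℕ) (i j v : ℤ) : σ.write a i j v a i j = v :=
  if_pos ⟨rfl, rfl, rfl⟩

theorem write_apply (σ : Mem) (a : ℕ) (i j v i' j' : ℤ) :
    σ.write a i j v a i' j' = if i' = i ∧ j' = j then v else σ a i' j' := by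
  simp [write]

theorem write_of_ne (σ : Mem) {a a' : ℕ} (h : a' ≠ a) (i j v : ℤ) : σ.write a i j v a' = σ a' := by
  ext i' j'
  simp [write, h]

end Mem

/-- All memory cells hold numbers of modulus at most `V`. -/
def Bounded (V : ℤ) (σ : Mem) : Prop := ∀ a i j, |σ a i j| ≤ V

theorem Bounded.write {V : ℤ} {σ : Mem} (h : Bounded V σ) (a : ℕ) (i j : ℤ) {v : ℤ} (hv : |v| ≤ V) :
    Bounded V (σ.write a i j v) := fun a' i' j' => by
  unfold Mem.write
  split_ifs
  exacts [hv, h _ _ _]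

/-- The memories agree outside the arrays in `S`. -/
def AgreeOff (S : List ℕ) (σ σ' : Mem) : Prop := ∀ a ∉ S, σ' a = σ a

namespace Expr

/-- The arrays an expression reads. -/
def reads : Expr → List ℕ
  | const _ => []
  | read a i j => a :: (i.reads ++ j.reads)
  | add e₁ e₂ => e₁.reads ++ e₂.reads
  | sub e₁ e₂ => e₁.reads ++ e₂.reads
  | mul e₁ e₂ => e₁.reads ++ e₂.reads

/-- An exponent `w` such that the value of the expression is at most `V ^ w` when the memory is
bounded by `V ≥ 2`. -/
def width : Expr → ℕ
  | const c => c.natAbs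
  | read _ i j => i.width + j.width + 1
  | add e₁ e₂ => e₁.width + e₂.width + 1
  | sub e₁ e₂ => e₁.width + e₂.width + 1
  | mul e₁ e₂ => e₁.width + e₂.width + 1

theorem eval_congr {σ τ : Mem} {e : Expr} (h : ∀ a ∈ e.reads, τ a = σ a) :
    e.eval τ = e.eval σ := by
  induction e with
  | const c => rfl
  | read a i j ihi ihj =>
    simp only [reads, List.mem_cons, List.mem_append] at h
    rw [eval, eval, h a (.inl rfl), ihi fun b hb => h b (.inr (.inl hb)),
      ihj fun b hb => h b (.inr (.inr hb))]
  | add e₁ e₂ ih₁ ih₂ | sub e₁ e₂ ih₁ ih₂ | mul e₁ e₂ ih₁ ih₂ =>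
    simp only [reads, List.mem_append] at h
    rw [eval, eval, ih₁ fun b hb => h b (.inl hb), ih₂ fun b hb => h b (.inr hb)]

theorem abs_eval_le {V : ℤ} (hV : 2 ≤ V) {σ : Mem} (hσ : Bounded V σ) (e : Expr) :
    |e.eval σ| ≤ V ^ e.width := by
  have hone : ∀ a : ℕ, 1 ≤ V ^ a := fun a => one_le_pow₀ (by lia)
  have hadd : ∀ a b : ℕ, V ^ a + V ^ b ≤ V ^ (a + b + 1) := fun a b =>
    calc V ^ a + V ^ b ≤ V ^ a * V ^ b * 2 := by nlinarith [hone a, hone b]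
      _ ≤ V ^ a * V ^ b * V := by gcongr
      _ = V ^ (a + b + 1) := by rw [pow_succ, pow_add]
  induction e with
  | const c =>
    calc |c| = (c.natAbs : ℤ) := Int.abs_eq_natAbs c
      _ ≤ 2 ^ c.natAbs := mod_cast Nat.lt_two_pow_self.le
      _ ≤ V ^ c.natAbs := by gcongr
  | read a i j => exact (hσ _ _ _).trans (le_self_pow₀ (by lia) (Nat.succ_ne_zero _))
  | add e₁ e₂ ih₁ ih₂ => exact (abs_add_le _ _).trans ((add_le_add ih₁ ih₂).trans (hadd _ _))
  | sub e₁ e₂ ih₁ ih₂ => exact (abs_sub _ _).trans ((add_le_add ih₁ ih₂).trans (hadd _ _))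
  | mul e₁ e₂ ih₁ ih₂ =>
    calc |e₁.eval σ * e₂.eval σ| ≤ V ^ e₁.width * V ^ e₂.width := by
          rw [abs_mul]
          gcongr
      _ = V ^ (e₁.width + e₂.width) := (pow_add _ _ _).symm
      _ ≤ V ^ (e₁.width + e₂.width + 1) := pow_le_pow_right₀ (by lia) (Nat.le_succ _)

end Expr

theorem bitLength_le_of_abs_le {x y : ℤ} (h : |x| ≤ |y|) : bitLength x ≤ bitLength y :=
  Nat.add_le_add_right (Nat.size_le_size (by simpa only [Int.abs_eq_natAbs, Nat.cast_le] using h)) 1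

theorem AgreeOff.eval_eq {S : List ℕ} {σ τ : Mem} (h : AgreeOff S σ τ) {e : Expr}
    (he : ∀ a ∈ e.reads, a ∉ S) : e.eval τ = e.eval σ :=
  Expr.eval_congr fun a ha => h a (he a ha)

theorem AgreeOff.append {S S' : List ℕ} {σ τ ρ : Mem} (h : AgreeOff S σ τ) (h' : AgreeOff S' τ ρ) :
    AgreeOff (S ++ S') σ ρ := fun a ha =>
  (h' a fun ha' => ha (List.mem_append_right _ ha')).trans
    (h a fun ha' => ha (List.mem_append_left _ ha'))

theorem Expr.fits {V : ℤ} (hV : 2 ≤ V) {σ : Mem} (hσ : Bounded V σ) {e : Expr} {w : ℕ}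
    (he : e.width ≤ w) : e.Fits (bitLength (V ^ w)) σ := by
  have hval : ∀ e : Expr, e.width ≤ w → bitLength (e.eval σ) ≤ bitLength (V ^ w) := fun e he =>
    bitLength_le_of_abs_le <| (e.abs_eval_le hV hσ).trans <|
      (pow_le_pow_right₀ (by lia) he).trans (le_abs_self _)
  induction e with
  | const c => exact hval _ he
  | read a i j ih₁ ih₂ | add i j ih₁ ih₂ | sub i j ih₁ ih₂ | mul i j ih₁ ih₂ =>
    have hval_e := hval _ he
    simp only [width] at he
    exact ⟨ih₁ (by lia), ih₂ (by lia), hval_e⟩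

namespace Prog

/-- The arrays a program writes to. -/
def writes : Prog → List ℕ
  | skip => []
  | store a _ _ _ => [a]
  | seq P Q => P.writes ++ Q.writes
  | ite _ _ P Q => P.writes ++ Q.writes
  | loop _ _ P => P.writes

/-- The largest width of an expression in the program. -/
def width : Prog → ℕ
  | skip => 0
  | store _ i j e => max i.width (max j.width e.width)
  | seq P Q => max P.width Q.width
  | ite e₁ e₂ P Q => max (max e₁.width e₂.width) (max P.width Q.width)
  | loop e₁ e₂ P => max (max e₁.width e₂.width) P.width

/-- The running time of a program all of whose loops are executed at most `X` times, as a polynomial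
in `X`. -/
noncomputable def time : Prog → Polynomial ℕ
  | skip => 1
  | store _ i j e => .C (i.cost + j.cost + e.cost + 1)
  | seq P Q => P.time + Q.time
  | ite e₁ e₂ P Q => .C (e₁.cost + e₂.cost + 1) + (P.time + Q.time)
  | loop e₁ e₂ P => .X * (.C (e₁.cost + e₂.cost + 1) + P.time) + .C (e₁.cost + e₂.cost + 1)

end Prog

theorem Exec.agreeOff {s : ℕ} {P : Prog} {σ σ' : Mem} {t : ℕ} (h : Exec s P σ t σ') :
    AgreeOff P.writes σ σ' := by
  induction h with
  | skip | loop_false => exact fun _ _ => rfl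
  | store => exact fun b hb => Mem.write_of_ne _ (List.ne_of_not_mem_cons hb) _ _ _
  | seq _ _ _ _ _ _ _ _ _ ih₁ ih₂ => exact ih₁.append ih₂
  | ite_true _ _ _ _ _ _ _ _ _ _ _ ih =>
    exact fun b hb => ih b fun h => hb (List.mem_append_left _ h)
  | ite_false _ _ _ _ _ _ _ _ _ _ _ ih =>
    exact fun b hb => ih b fun h => hb (List.mem_append_right _ h)
  | loop_true _ _ _ _ _ _ _ _ _ _ _ _ _ ih₁ ih₂ => exact fun b hb => (ih₂ b hb).trans (ih₁ b hb)

/-- The resources of a computation: the number of iterations of a single loop, a bound for the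
numbers in memory, and a bound for the width of the expressions. -/
structure Budget where
  loops : ℕ
  size : ℤ
  width : ℕ
  loops_add_two_le : loops + 2 ≤ size

theorem Budget.two_le_size (B : Budget) : 2 ≤ B.size := by
  have := B.loops_add_two_le
  lia

/-- Weakest precondition for total correctness: from `σ`, the program halts within the budget, in
a state that satisfies `Q`. -/
def WP (B : Budget) (P : Prog) (Q : Mem → Prop) (σ : Mem) : Prop :=
  P.width ≤ B.width → Bounded B.size σ →
    ∃ t σ', Exec (bitLength (B.size ^ B.width)) P σ t σ' ∧ t ≤ P.time.eval B.loops ∧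
      Bounded B.size σ' ∧ Q σ'

namespace WP

variable {B : Budget} {P P' : Prog} {Q Q' : Mem → Prop} {σ : Mem}

theorem of_bounded (h : Bounded B.size σ → WP B P Q σ) : WP B P Q σ := fun hw hσ => h hσ hw hσ

theorem mono_agreeOff (h : WP B P Q σ) (hQ : ∀ σ', AgreeOff P.writes σ σ' → Q σ' → Q' σ') :
    WP B P Q' σ := fun hw hσ =>
  let ⟨t, σ', hexec, ht, hσ', hQ'⟩ := h hw hσ
  ⟨t, σ', hexec, ht, hσ', hQ σ' hexec.agreeOff hQ'⟩

theorem mono (h : WP B P Q σ) (hQ : ∀ σ', Q σ' → Q' σ') : WP B P Q' σ :=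
  h.mono_agreeOff fun σ' _ => hQ σ'

theorem skip (h : Q σ) : WP B .skip Q σ := fun _ hσ =>
  ⟨1, σ, .skip σ, by simp [Prog.time], hσ, h⟩

theorem store {a : ℕ} {i j e : Expr} (he : |e.eval σ| ≤ B.size)
    (h : Q (σ.write a (i.eval σ) (j.eval σ) (e.eval σ))) : WP B (.store a i j e) Q σ :=
  fun hw hσ => by
    simp only [Prog.width, max_le_iff] at hw
    exact ⟨_, _, .store a i j e σ (Expr.fits B.two_le_size hσ hw.1)
      (Expr.fits B.two_le_size hσ hw.2.1) (Expr.fits B.two_le_size hσ hw.2.2),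
      by simp [Prog.time], hσ.write _ _ _ he, h⟩

theorem seq (h : WP B P Q' σ) (h' : ∀ σ', AgreeOff P.writes σ σ' → Q' σ' → WP B P' Q σ') :
    WP B (.seq P P') Q σ := fun hw hσ => by
  simp only [Prog.width, max_le_iff] at hw
  obtain ⟨t, τ, hexec, ht, hτ, hQ⟩ := h hw.1 hσ
  obtain ⟨t', τ', hexec', ht', hτ', hQ'⟩ := h' τ hexec.agreeOff hQ hw.2 hτ
  exact ⟨_, τ', .seq _ _ _ _ _ _ _ hexec hexec', by simpa [Prog.time] using add_le_add ht ht',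
    hτ', hQ'⟩

theorem ite {e₁ e₂ : Expr} (h : e₁.eval σ ≤ e₂.eval σ → WP B P Q σ)
    (h' : ¬ e₁.eval σ ≤ e₂.eval σ → WP B P' Q σ) : WP B (.ite e₁ e₂ P P') Q σ := fun hw hσ => by
  simp only [Prog.width, max_le_iff] at hw
  have hfit₁ := Expr.fits B.two_le_size hσ hw.1.1
  have hfit₂ := Expr.fits B.two_le_size hσ hw.1.2
  by_cases hc : e₁.eval σ ≤ e₂.eval σ
  · obtain ⟨t, τ, hexec, ht, hτ, hQ⟩ := h hc hw.2.1 hσ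
    refine ⟨_, τ, .ite_true _ _ _ _ _ _ _ hfit₁ hfit₂ hc hexec, ?_, hτ, hQ⟩
    simp only [Prog.time, Polynomial.eval_add, Polynomial.eval_C]
    lia
  · obtain ⟨t, τ, hexec, ht, hτ, hQ⟩ := h' hc hw.2.2 hσ
    refine ⟨_, τ, .ite_false _ _ _ _ _ _ _ hfit₁ hfit₂ hc hexec, ?_, hτ, hQ⟩
    simp only [Prog.time, Polynomial.eval_add, Polynomial.eval_C]
    lia

theorem loop {e₁ e₂ : Expr} (I : ℕ → Mem → Prop) {d : ℕ} (hd : d ≤ B.loops) (h : I d σ)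
    (hbody : ∀ d τ, I (d + 1) τ → e₁.eval τ ≤ e₂.eval τ ∧ WP B P (I d) τ)
    (hexit : ∀ τ, I 0 τ → ¬ e₁.eval τ ≤ e₂.eval τ) : WP B (.loop e₁ e₂ P) (I 0) σ := fun hw hσ => by
  simp only [Prog.width, max_le_iff] at hw
  set c := e₁.cost + e₂.cost + 1
  suffices hruns : ∀ d σ, I d σ → Bounded B.size σ → ∃ t σ',
      Exec (bitLength (B.size ^ B.width)) (.loop e₁ e₂ P) σ t σ' ∧
        t ≤ d * (c + P.time.eval B.loops) + c ∧ Bounded B.size σ' ∧ I 0 σ' by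
    obtain ⟨t, σ', hexec, ht, hσ', hI⟩ := hruns d σ h hσ
    refine ⟨t, σ', hexec, ht.trans ?_, hσ', hI⟩
    simp only [Prog.time, Polynomial.eval_add, Polynomial.eval_mul, Polynomial.eval_X,
      Polynomial.eval_C]
    gcongr
  intro d
  induction d with
  | zero =>
    exact fun σ hI hσ => ⟨c, σ, .loop_false _ _ _ _ (Expr.fits B.two_le_size hσ hw.1.1)
      (Expr.fits B.two_le_size hσ hw.1.2) (hexit σ hI), by simp, hσ, hI⟩
  | succ d ih =>
    intro σ hI hσ
    obtain ⟨hguard, hwp⟩ := hbody d σ hI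
    obtain ⟨t, τ, hexec, ht, hτ, hIτ⟩ := hwp hw.2 hσ
    obtain ⟨t', τ', hexec', ht', hτ', hIτ'⟩ := ih τ hIτ hτ
    refine ⟨_, τ', .loop_true _ _ _ _ _ _ _ _ (Expr.fits B.two_le_size hσ hw.1.1)
      (Expr.fits B.two_le_size hσ hw.1.2) hguard hexec hexec', ?_, hτ', hIτ'⟩
    rw [add_one_mul]
    lia

end WP

/-! ### Counting loops -/

@[simp] theorem Expr.eval_const (c : ℤ) (σ : Mem) : (Expr.const c).eval σ = c := rfl

@[simp] theorem Expr.eval_read (a : ℕ) (i j : Expr) (σ : Mem) :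
    (Expr.read a i j).eval σ = σ a (i.eval σ) (j.eval σ) := rfl

@[simp] theorem Expr.eval_add (e₁ e₂ : Expr) (σ : Mem) :
    (Expr.add e₁ e₂).eval σ = e₁.eval σ + e₂.eval σ := rfl

@[simp] theorem Expr.eval_sub (e₁ e₂ : Expr) (σ : Mem) :
    (Expr.sub e₁ e₂).eval σ = e₁.eval σ - e₂.eval σ := rfl

@[simp] theorem Expr.eval_mul (e₁ e₂ : Expr) (σ : Mem) :
    (Expr.mul e₁ e₂).eval σ = e₁.eval σ * e₂.eval σ := rfl

/-- The scalar variable kept in cell `(0, 0)` of array `v`. -/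
def var (v : ℕ) : Expr := .read v (.const 0) (.const 0)

@[simp] theorem eval_var (v : ℕ) (σ : Mem) : (var v).eval σ = σ v 0 0 := rfl

/-- The assignment `v := e` to a scalar variable. -/
def assign (v : ℕ) (e : Expr) : Prog := .store v (.const 0) (.const 0) e

/-- `for v = lo, …, hi - 1 do body`; the bound `hi` is evaluated afresh in every iteration. -/
def forLoop (v : ℕ) (lo hi : Expr) (body : Prog) : Prog :=
  .seq (assign v lo)
    (.loop (.add (var v) (.const 1)) hi (.seq body (assign v (.add (var v) (.const 1)))))

namespace WP

variable {B : Budget} {body : Prog} {Q : Mem → Prop} {σ : Mem} {a v : ℕ} {lo hi : Expr} {l h : ℤ}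

theorem assign {e : Expr} (he : |e.eval σ| ≤ B.size) (h : Q (σ.write v 0 0 (e.eval σ))) :
    WP B (assign v e) Q σ :=
  WP.store he h

theorem forLoop (I : ℤ → Mem → Prop) (hlo : lo.eval σ = l) (hhi : hi.eval σ = h) (hl : 0 ≤ l)
    (hlh : l ≤ h) (hh : h ≤ B.loops) (hv : v ∉ body.writes)
    (hreads : ∀ r ∈ hi.reads, r ∉ v :: body.writes)
    (hI : I l σ) (hIv : ∀ t τ x, I t τ → I t (τ.write v 0 0 x))
    (hbody : ∀ t τ, l ≤ t → t < h → τ v 0 0 = t → AgreeOff (v :: body.writes) σ τ → I t τ →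
      WP B body (I (t + 1)) τ) :
    WP B (forLoop v lo hi body) (I h) σ := by
  have hsize := B.loops_add_two_le
  have hagree_write : ∀ τ x, AgreeOff (v :: body.writes) σ τ →
      AgreeOff (v :: body.writes) σ (τ.write v 0 0 x) := fun τ x hτ b hb => by
    rw [Mem.write_of_ne _ (List.ne_of_not_mem_cons hb), hτ b hb]
  have hhi_eval : ∀ τ, AgreeOff (v :: body.writes) σ τ → hi.eval τ = h := fun τ hτ => by
    rw [hτ.eval_eq hreads, hhi]
  refine WP.seq (Q' := fun τ => τ v 0 0 = l ∧ AgreeOff (v :: body.writes) σ τ ∧ I l τ)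
    (WP.assign (by rw [hlo, abs_of_nonneg hl]; lia)
      ⟨by rw [Mem.write_same, hlo], hagree_write _ _ fun _ _ => rfl, hIv _ _ _ hI⟩) ?_
  rintro τ - ⟨hτv, hτ, hτI⟩
  refine (WP.loop (d := (h - l).toNat) (fun d τ => l ≤ h - d ∧ τ v 0 0 = h - d ∧
    AgreeOff (v :: body.writes) σ τ ∧ I (h - d) τ) (by lia) ?_ ?_ ?_).mono fun τ hτ => by
      simpa using hτ.2.2.2
  · rw [Int.toNat_of_nonneg (by lia), sub_sub_cancel]
    exact ⟨le_rfl, hτv, hτ, hτI⟩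
  · rintro d τ ⟨hd, hτv, hτ, hτI⟩
    push_cast at hd hτv hτI
    refine ⟨by rw [hhi_eval τ hτ, Expr.eval_add, eval_var, Expr.eval_const]; lia, ?_⟩
    refine WP.seq (hbody _ τ hd (by lia) hτv hτ hτI) fun τ' hττ' hI' => ?_
    have hval : (Expr.add (var v) (.const 1)).eval τ' = h - d := by
      rw [Expr.eval_add, eval_var, Expr.eval_const, hττ' v hv, hτv]
      ring
    rw [show h - (d + 1 : ℤ) + 1 = h - d by ring] at hI'
    refine WP.assign (by rw [hval, abs_le]; lia) ?_
    rw [hval]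
    exact ⟨by lia, Mem.write_same .., hagree_write _ _ fun b hb => by
      rw [hττ' b (List.not_mem_of_not_mem_cons hb), hτ b hb], hIv _ _ _ hI'⟩
  · rintro τ ⟨-, hτv, hτ, -⟩
    rw [hhi_eval τ hτ, Expr.eval_add, eval_var, Expr.eval_const, hτv]
    simp

theorem forLoop_array (I : ℤ → (ℤ → ℤ → ℤ) → Prop) (hlo : lo.eval σ = l) (hhi : hi.eval σ = h)
    (hl : 0 ≤ l) (hlh : l ≤ h) (hh : h ≤ B.loops) (hav : a ≠ v) (hv : v ∉ body.writes)
    (hreads : ∀ r ∈ hi.reads, r ∉ v :: body.writes) (hI : I l (σ a))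
    (hbody : ∀ t τ, l ≤ t → t < h → τ v 0 0 = t → AgreeOff (v :: body.writes) σ τ → I t (τ a) →
      WP B body (fun τ' => I (t + 1) (τ' a)) τ) :
    WP B (_root_.forLoop v lo hi body) (fun σ' => I h (σ' a)) σ :=
  WP.forLoop (fun t τ => I t (τ a)) hlo hhi hl hlh hh hv hreads hI
    (fun t τ x hI => by rwa [Mem.write_of_ne _ hav]) hbody

/-- A loop that stores `f t` into cell `(p t, q t)`. Iteration `t` may read array `a` outside the
cells written before. -/
theorem forLoop_store {i j e : Expr} (p q f : ℤ → ℤ) (hlo : lo.eval σ = l) (hhi : hi.eval σ = h)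
    (hl : 0 ≤ l) (hlh : l ≤ h) (hh : h ≤ B.loops) (hav : a ≠ v)
    (hreads : ∀ r ∈ hi.reads, r ∉ [v, a])
    (hinj : ∀ s t, s < t → p s = p t → q s ≠ q t) (hf : ∀ t, l ≤ t → t < h → |f t| ≤ B.size)
    (heval : ∀ t τ, l ≤ t → t < h → τ v 0 0 = t → AgreeOff [v, a] σ τ →
      (∀ x y, (∀ s, l ≤ s → s < t → p s = x → q s ≠ y) → τ a x y = σ a x y) →
      i.eval τ = p t ∧ j.eval τ = q t ∧ e.eval τ = f t) :
    WP B (_root_.forLoop v lo hi (.store a i j e))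
      (fun σ' => (∀ t, l ≤ t → t < h → σ' a (p t) (q t) = f t) ∧
        ∀ x y, (∀ t, l ≤ t → t < h → p t = x → q t ≠ y) → σ' a x y = σ a x y) σ := by
  refine forLoop_array (fun u A => (∀ t, l ≤ t → t < u → A (p t) (q t) = f t) ∧
      ∀ x y, (∀ t, l ≤ t → t < u → p t = x → q t ≠ y) → A x y = σ a x y)
    hlo hhi hl hlh hh hav (fun hva => hav (List.mem_singleton.mp hva).symm) hreads
    ⟨fun t hlt htl => absurd htl (not_lt.mpr hlt), fun x y _ => rfl⟩ ?_
  intro t τ hlt hth hτv hτ ⟨hdone, hrest⟩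
  obtain ⟨hi, hj, he⟩ := heval t τ hlt hth hτv hτ hrest
  refine WP.store (by rw [he]; exact hf t hlt hth) ?_
  rw [hi, hj, he]
  refine ⟨fun s hls hst => ?_, fun x y hxy => ?_⟩
  · rw [Mem.write_apply]
    obtain rfl | hne := eq_or_ne s t
    · rw [if_pos ⟨rfl, rfl⟩]
    · have hlt : s < t := by lia
      rw [if_neg fun hst => hinj s t hlt hst.1 hst.2, hdone s hls hlt]
  · rw [Mem.write_apply, if_neg fun hxy' => hxy t hlt (by lia) hxy'.1.symm hxy'.2.symm]
    exact hrest x y fun s hls hst => hxy s hls (by lia)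

end WP

/-! ### The decomposition program -/

-- The arrays and scalar variables of the program; `rows`, …, `vectors` are prescribed by the
-- format of input and output. Column `n` of `tab` holds the current vector.
namespace Reg

abbrev rows : ℕ := 0
abbrev cols : ℕ := 1
abbrev matrix : ℕ := 2
abbrev source : ℕ := 4
abbrev target : ℕ := 5
abbrev coeffs : ℕ := 6
abbrev vectors : ℕ := 7
abbrev tab : ℕ := 8
abbrev savedVec : ℕ := 9
abbrev savedRow : ℕ := 10
abbrev round : ℕ := 11
abbrev col : ℕ := 12
abbrev row : ℕ := 13
abbrev entry : ℕ := 14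
abbrev pivot : ℕ := 15
abbrev factor : ℕ := 16

end Reg

/-- The number `n + k` of rows of the tableau. -/
def tabRows : Expr := .add (var Reg.cols) (var Reg.rows)

/-- The entry `(i, j)` of the tableau, for scalar variables `i` and `j`. -/
def tabEntry (i j : ℕ) : Expr := .read Reg.tab (var i) (var j)

/-- Make `row` the new `pivot` if it is the better candidate in the ratio test. -/
def compareRow : Prog :=
  .ite (.mul (tabEntry Reg.row Reg.col) (tabEntry Reg.row Reg.col)) (.const 0) .skip
    (.ite (.mul (tabEntry Reg.pivot Reg.col) (tabEntry Reg.pivot Reg.col)) (.const 0)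
      (assign Reg.pivot (var Reg.row))
      (.ite (.mul (tabEntry Reg.pivot Reg.cols) (tabEntry Reg.pivot Reg.cols))
        (.mul (tabEntry Reg.row Reg.cols) (tabEntry Reg.row Reg.cols))
        .skip (assign Reg.pivot (var Reg.row))))

/-- The ratio test: among the rows with a nonzero entry in column `col`, find one whose entry in
the current vector has least modulus. -/
def searchRow : Prog :=
  .seq (assign Reg.pivot (.const 0)) (forLoop Reg.row (.const 0) tabRows compareRow)

/-- Save the pivot row, minus the unit vector of column `col`, times the pivot. -/
def saveRow : Prog :=
  .seq (forLoop Reg.entry (.const 0) (.add (var Reg.cols) (.const 1))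
      (.store Reg.savedRow (.const 0) (var Reg.entry)
        (.mul (tabEntry Reg.pivot Reg.col) (tabEntry Reg.pivot Reg.entry))))
    (.store Reg.savedRow (.const 0) (var Reg.col)
      (.mul (tabEntry Reg.pivot Reg.col) (.sub (tabEntry Reg.pivot Reg.col) (.const 1))))

/-- Subtract from every row the saved row times the entry in column `col`. -/
def subtractRows : Prog :=
  forLoop Reg.row (.const 0) tabRows
    (.seq (assign Reg.factor (tabEntry Reg.row Reg.col))
      (forLoop Reg.entry (.const 0) (.add (var Reg.cols) (.const 1))
        (.store Reg.tab (var Reg.row) (var Reg.entry)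
          (.sub (tabEntry Reg.row Reg.entry)
            (.mul (var Reg.factor) (.read Reg.savedRow (.const 0) (var Reg.entry)))))))

/-- The pivot step in row `pivot` and column `col`, applied to the tableau and the vector. -/
def eliminate : Prog := .seq saveRow subtractRows

/-- Save the current vector. -/
def saveVec : Prog :=
  forLoop Reg.row (.const 0) tabRows
    (.store Reg.savedVec (var Reg.row) (.const 0) (tabEntry Reg.row Reg.cols))

/-- Reset the current vector to the saved one. -/
def restoreVec : Prog :=
  forLoop Reg.row (.const 0) tabRows
    (.store Reg.tab (var Reg.row) (var Reg.cols) (.read Reg.savedVec (var Reg.row) (.const 0)))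

/-- Pivot in all columns after the `round`-th one. -/
def reduceCols : Prog :=
  forLoop Reg.col (.add (var Reg.round) (.const 1)) (var Reg.cols) (.seq searchRow eliminate)

/-- Set `factor` to the sign that makes the coefficient of the current round nonnegative. -/
def chooseSign : Prog :=
  .ite (.const 0) (.mul (tabEntry Reg.pivot Reg.col) (tabEntry Reg.pivot Reg.cols))
    (assign Reg.factor (.const 1)) (assign Reg.factor (.const (-1)))

/-- Output the coefficient of the current round. -/
def emitCoeff : Prog :=
  .store Reg.coeffs (var Reg.round) (.const 0)
    (.mul (var Reg.factor) (.mul (tabEntry Reg.pivot Reg.col) (tabEntry Reg.pivot Reg.cols)))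

/-- Output the vector of the current round. -/
def emitVector : Prog :=
  forLoop Reg.entry (.const 0) (var Reg.cols)
    (.store Reg.vectors (var Reg.round) (var Reg.entry)
      (.mul (var Reg.factor) (tabEntry Reg.entry Reg.col)))

/-- Output the coefficient and the vector of the current round. -/
def emit : Prog := .seq chooseSign (.seq emitCoeff emitVector)

/-- Pivot until the multiples of column `round` in the remainder are conformal to it. -/
def reduceRound : Prog := .seq saveVec (.seq reduceCols restoreVec)

/-- Split off the largest conformal multiple of column `round`. -/
def splitColumn : Prog :=
  .seq (assign Reg.col (var Reg.round)) (.seq searchRow (.seq emit eliminate))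

/-- Set up the unit rows of the tableau. -/
def initUnits : Prog :=
  forLoop Reg.row (.const 0) (var Reg.cols)
    (.store Reg.tab (var Reg.row) (var Reg.row) (.const 1))

/-- Set up the entries of `y - x₀` in the unit rows of the current vector. -/
def initDiff : Prog :=
  forLoop Reg.row (.const 0) (var Reg.cols)
    (.store Reg.tab (var Reg.row) (var Reg.cols)
      (.sub (.read Reg.target (var Reg.row) (.const 0))
        (.read Reg.source (var Reg.row) (.const 0))))

/-- Copy row `row` of `T` into the tableau. -/
def copyRow : Prog :=
  forLoop Reg.entry (.const 0) (var Reg.cols)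
    (.store Reg.tab (.add (var Reg.cols) (var Reg.row)) (var Reg.entry)
      (.read Reg.matrix (var Reg.row) (var Reg.entry)))

/-- Compute the product of row `row` of `T` with `y - x₀`. -/
def dotRow : Prog :=
  forLoop Reg.entry (.const 0) (var Reg.cols)
    (.store Reg.tab (.add (var Reg.cols) (var Reg.row)) (var Reg.cols)
      (.add (.read Reg.tab (.add (var Reg.cols) (var Reg.row)) (var Reg.cols))
        (.mul (.read Reg.matrix (var Reg.row) (var Reg.entry))
          (tabEntry Reg.entry Reg.cols))))

/-- Set up the tableau of the stacked matrix and the vector `y - x₀`. -/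
def initTab : Prog :=
  .seq initUnits (.seq initDiff
    (forLoop Reg.row (.const 0) (var Reg.rows) (.seq copyRow dotRow)))

/-- The decomposition algorithm. -/
def decomposeProg : Prog :=
  .seq initTab (forLoop Reg.round (.const 0) (var Reg.cols) (.seq reduceRound splitColumn))

/-! ### Correctness of the pivot step -/

/-- The memory holds the dimensions of the system, and the tableau fits the budget. -/
structure Dims (B : Budget) (k n : ℕ) (σ : Mem) : Prop where
  rows : σ Reg.rows 0 0 = k
  cols : σ Reg.cols 0 0 = n
  lt_loops : n + k < B.loops

/-- The position in memory of a row of the stacked matrix. -/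
def rowIndex {k n : ℕ} : Fin n ⊕ Fin k → ℤ
  | .inl j => (j : ℕ)
  | .inr i => n + (i : ℕ)

/-- Row `r` of the array `A` holds the row `r` of `N` and, in column `n`, the entry `r` of `w`. -/
structure HoldsRow {k n : ℕ} (A : ℤ → ℤ → ℤ) (N : Matrix (Fin n ⊕ Fin k) (Fin n) ℤ)
    (w : Fin n ⊕ Fin k → ℤ) (r : Fin n ⊕ Fin k) : Prop where
  mat : ∀ c : Fin n, A (rowIndex r) (c : ℕ) = N r c
  vec : A (rowIndex r) n = w r

theorem exists_fin_cast {n : ℕ} {t : ℤ} (h0 : 0 ≤ t) (hn : t < n) : ∃ a : Fin n, t = (a : ℕ) :=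
  ⟨⟨t.toNat, by lia⟩, (Int.toNat_of_nonneg h0).symm⟩

section Pivot

variable {B : Budget} {k n : ℕ} {σ σ' : Mem} {N : Matrix (Fin n ⊕ Fin k) (Fin n) ℤ}
  {w : Fin n ⊕ Fin k → ℤ} {c : Fin n} {i : Fin n ⊕ Fin k}

theorem Dims.frame {S : List ℕ} (h : Dims B k n σ) (hf : AgreeOff S σ σ') (hrows : Reg.rows ∉ S)
    (hcols : Reg.cols ∉ S) : Dims B k n σ' :=
  ⟨by rw [hf _ hrows, h.rows], by rw [hf _ hcols, h.cols], h.lt_loops⟩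

theorem Dims.eval_tabRows (h : Dims B k n σ) : tabRows.eval σ = n + k := by
  rw [tabRows, Expr.eval_add, eval_var, eval_var, h.cols, h.rows]

@[simp] theorem eval_tabEntry (v v' : ℕ) (σ : Mem) :
    (tabEntry v v').eval σ = σ Reg.tab (σ v 0 0) (σ v' 0 0) := rfl

theorem rowIndex_nonneg (r : Fin n ⊕ Fin k) : 0 ≤ rowIndex r := by
  cases r <;> simp only [rowIndex] <;> lia

theorem rowIndex_lt (r : Fin n ⊕ Fin k) : rowIndex r < n + k := by
  cases r <;> simp only [rowIndex] <;> omega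

theorem rowIndex_injective : Function.Injective (rowIndex : Fin n ⊕ Fin k → ℤ) := by
  rintro (j | i) (j' | i') h <;> simp only [rowIndex] at h
  · exact congrArg _ (by omega)
  · omega
  · omega
  · exact congrArg _ (by omega)

theorem exists_rowIndex {t : ℤ} (h0 : 0 ≤ t) (hnk : t < n + k) :
    ∃ r : Fin n ⊕ Fin k, t = rowIndex r := by
  obtain hn | hn := lt_or_ge t n
  · obtain ⟨j, rfl⟩ := exists_fin_cast h0 hn
    exact ⟨.inl j, rfl⟩
  · obtain ⟨i, hi⟩ := exists_fin_cast (n := k) (t := t - n) (by lia) (by lia)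
    exact ⟨.inr i, by rw [rowIndex, ← hi, add_sub_cancel]⟩

/-- Row `i` wins the ratio test among the rows before position `t`. -/
def IsBestRow (N : Matrix (Fin n ⊕ Fin k) (Fin n) ℤ) (w : Fin n ⊕ Fin k → ℤ) (c : Fin n) (t : ℤ)
    (i : Fin n ⊕ Fin k) : Prop :=
  ∀ j : Fin n ⊕ Fin k, rowIndex j < t → N j c ≠ 0 → N i c ≠ 0 ∧ |w i| ≤ |w j|

theorem isBestRow_succ {r : Fin n ⊕ Fin k} : IsBestRow N w c (rowIndex r + 1) i ↔
    IsBestRow N w c (rowIndex r) i ∧ (N r c ≠ 0 → N i c ≠ 0 ∧ |w i| ≤ |w r|) := by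
  refine ⟨fun h => ⟨fun j hj => h j (by lia), h r (by lia)⟩, fun h j hj => ?_⟩
  obtain hlt | heq := (Int.lt_add_one_iff.mp hj).lt_or_eq
  · exact h.1 j hlt
  · exact rowIndex_injective heq ▸ h.2

theorem wp_compareRow {r : Fin n ⊕ Fin k} (hd : Dims B k n σ) (hc : σ Reg.col 0 0 = (c : ℕ))
    (hr : σ Reg.row 0 0 = rowIndex r) (hi : σ Reg.pivot 0 0 = rowIndex i)
    (hA : ∀ r, HoldsRow (σ Reg.tab) N w r) (hbest : IsBestRow N w c (rowIndex r) i) :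
    WP B compareRow (fun σ' => ∃ i, σ' Reg.pivot 0 0 = rowIndex i ∧
      IsBestRow N w c (rowIndex r + 1) i) σ := by
  have hkeep (h : N r c ≠ 0 → N i c ≠ 0 ∧ |w i| ≤ |w r|) : WP B .skip (fun σ' => ∃ i,
      σ' Reg.pivot 0 0 = rowIndex i ∧ IsBestRow N w c (rowIndex r + 1) i) σ :=
    WP.skip ⟨i, hi, isBestRow_succ.mpr ⟨hbest, h⟩⟩
  have hreplace (h : IsBestRow N w c (rowIndex r) r) : WP B (assign Reg.pivot (var Reg.row))
      (fun σ' => ∃ i, σ' Reg.pivot 0 0 = rowIndex i ∧ IsBestRow N w c (rowIndex r + 1) i) σ :=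
    WP.of_bounded fun hB => WP.assign (hB _ _ _)
      ⟨r, by rw [Mem.write_same, eval_var, hr], isBestRow_succ.mpr ⟨h, fun hr => ⟨hr, le_rfl⟩⟩⟩
  refine WP.ite (fun hrc => hkeep ?_) fun hrc => WP.ite (fun hic => hreplace ?_) fun hic =>
    WP.ite (fun hle => hkeep ?_) fun hlt => hreplace ?_
  all_goals simp only [Expr.eval_mul, Expr.eval_const, eval_tabEntry, hr, hi, hc, hd.cols,
    (hA _).mat, (hA _).vec, ← sq, sq_nonpos_iff, sq_le_sq] at *
  · exact fun h => absurd hrc h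
  · exact fun j hj hjc => absurd hic (hbest j hj hjc).1
  · exact fun _ => ⟨hic, hle⟩
  · exact fun j hj hjc => ⟨hrc, (not_le.mp hlt).le.trans (hbest j hj hjc).2⟩

theorem wp_searchRow (hd : Dims B k n σ) (hc : σ Reg.col 0 0 = (c : ℕ))
    (hA : ∀ r, HoldsRow (σ Reg.tab) N w r) (hN : ∃ r, N r c ≠ 0) :
    WP B searchRow (fun σ' => ∃ i, σ' Reg.pivot 0 0 = rowIndex i ∧ IsRatioRow N w c i) σ := by
  obtain ⟨r₀, hr₀⟩ := hN
  have hc_lt := c.isLt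
  have hlt := hd.lt_loops
  refine WP.seq (Q' := fun τ => τ Reg.pivot 0 0 = 0)
    (WP.assign (by simpa using B.two_le_size.trans' zero_le_two) (Mem.write_same ..))
    fun τ hτ hpivot => ?_
  refine (WP.forLoop_array (l := 0) (a := Reg.pivot)
    (fun t X => ∃ i : Fin n ⊕ Fin k, X 0 0 = rowIndex i ∧ IsBestRow N w c t i)
    rfl (hd.frame hτ (by decide) (by decide)).eval_tabRows le_rfl (by lia) (by lia) (by decide)
    (by decide) (by decide) ?_ ?_).mono fun σ' ⟨i, hi, hbest⟩ =>
      ⟨i, hi, (hbest r₀ (rowIndex_lt _) hr₀).1, fun j hj => (hbest j (rowIndex_lt _) hj).2⟩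
  · obtain ⟨r, hr⟩ := exists_rowIndex (n := n) (k := k) le_rfl (by lia)
    exact ⟨r, by rw [hpivot, hr], fun j hj => absurd hj (rowIndex_nonneg j).not_gt⟩
  intro t τ' ht0 htnk hrow hττ' ⟨i, hi, hbest⟩
  obtain ⟨r, rfl⟩ := exists_rowIndex ht0 htnk
  have hστ' := hτ.append hττ'
  exact wp_compareRow (hd.frame hστ' (by decide) (by decide)) (by rw [hστ' _ (by decide), hc]) hrow
    hi (by rwa [hστ' _ (by decide)]) hbest

theorem wp_saveRow (hd : Dims B k n σ) (hc : σ Reg.col 0 0 = (c : ℕ))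
    (hi : σ Reg.pivot 0 0 = rowIndex i) (hA : HoldsRow (σ Reg.tab) N w i) (hN : |N i c| ≤ 1) :
    WP B saveRow (fun σ' =>
      (∀ a : Fin n, σ' Reg.savedRow 0 (a : ℕ) = N i c * (N i a - if a = c then 1 else 0)) ∧
        σ' Reg.savedRow 0 n = N i c * w i) σ := by
  have hsize := B.two_le_size
  have hlt := hd.lt_loops
  have hpivot : (tabEntry Reg.pivot Reg.col).eval σ = N i c := by simp [hc, hi, hA.mat]
  have habs_mul (x : ℤ) : |N i c * x| ≤ |x| := by
    rw [abs_mul]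
    exact mul_le_of_le_one_left (abs_nonneg _) hN
  refine WP.of_bounded fun hB => WP.seq (WP.forLoop_store (l := 0) (h := n + 1) (fun _ => 0)
    (fun t => t) (fun t => N i c * σ Reg.tab (rowIndex i) t) rfl (by simp [hd.cols]) le_rfl (by lia)
    (by lia) (by decide) (by decide) (fun s t hst _ => hst.ne)
    (fun t _ _ => (habs_mul _).trans (hB _ _ _)) fun t τ _ _ ht hτ _ => ⟨rfl, ht, ?_⟩)
    fun τ hτ ⟨hrow, _⟩ => ?_
  · rw [Expr.eval_mul, hτ.eval_eq (by decide), hpivot, eval_tabEntry, hτ _ (by decide),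
      hτ Reg.pivot (by decide), hi, ht]
  · have hfix : (Expr.mul (tabEntry Reg.pivot Reg.col)
        (.sub (tabEntry Reg.pivot Reg.col) (.const 1))).eval τ = N i c * (N i c - 1) := by
      rw [hτ.eval_eq (by decide), Expr.eval_mul, Expr.eval_sub, hpivot, Expr.eval_const]
    have hcol : τ Reg.col 0 0 = (c : ℕ) := by rw [hτ _ (by decide), hc]
    refine WP.store ?_ ?_
    · rw [hfix]
      exact (habs_mul _).trans ((abs_sub _ _).trans ((add_le_add_left hN _).trans hsize))
    · rw [hfix, Expr.eval_const, eval_var, hcol]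
      refine ⟨fun a => ?_, ?_⟩
      · rw [Mem.write_apply]
        split_ifs with h h' h'
        · rw [h']
        · exact absurd (Fin.ext (by omega)) h'
        · exact absurd ⟨rfl, by rw [h']⟩ h
        · rw [hrow _ (by omega) (by omega), sub_zero, hA.mat]
      · rw [Mem.write_apply, if_neg (by omega), hrow _ (by omega) (by omega), hA.vec]

theorem wp_subtractRows (hd : Dims B k n σ) (hc : σ Reg.col 0 0 = (c : ℕ))
    (hbd : ∀ x y : ℤ, 0 ≤ x → x < n + k → 0 ≤ y → y ≤ n →
      |σ Reg.tab x y - σ Reg.tab x (c : ℕ) * σ Reg.savedRow 0 y| ≤ B.size) :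
    WP B subtractRows (fun σ' => ∀ x y : ℤ, 0 ≤ x → x < n + k → 0 ≤ y → y ≤ n →
      σ' Reg.tab x y = σ Reg.tab x y - σ Reg.tab x (c : ℕ) * σ Reg.savedRow 0 y) σ := by
  have hlt := hd.lt_loops
  refine (WP.forLoop_array (l := 0) (h := n + k) (a := Reg.tab)
    (fun t A => ∀ x y : ℤ, 0 ≤ x → 0 ≤ y → y ≤ n → A x y = if x < t then
      σ Reg.tab x y - σ Reg.tab x (c : ℕ) * σ Reg.savedRow 0 y else σ Reg.tab x y)
    rfl hd.eval_tabRows le_rfl (by lia) (by lia) (by decide) (by decide) (by decide)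
    (fun x y hx _ _ => (if_neg hx.not_gt).symm) ?_).mono fun σ' h x y hx hxk hy hyn => by
      rw [h x y hx hy hyn, if_pos hxk]
  intro t τ ht htnk hrow hτ hI
  have hI_row (y : ℤ) (hy : 0 ≤ y) (hyn : y ≤ n) : τ Reg.tab t y = σ Reg.tab t y := by
    rw [hI t y ht hy hyn, if_neg (lt_irrefl t)]
  refine WP.seq (Q' := fun τ' => τ' Reg.factor 0 0 = σ Reg.tab t (c : ℕ))
    (WP.of_bounded fun hB => WP.assign (hB _ _ _) ?_) fun τ₁ hτ₁ hfactor => ?_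
  · rw [Mem.write_same, eval_tabEntry, hrow, hτ Reg.col (by decide), hc,
      hI_row _ (by omega) (by omega)]
  refine (WP.forLoop_store (l := 0) (h := n + 1) (fun _ => t) (fun y => y)
    (fun y => σ Reg.tab t y - σ Reg.tab t (c : ℕ) * σ Reg.savedRow 0 y) rfl
    (by simp [hτ₁ Reg.cols (by decide), hτ Reg.cols (by decide), hd.cols]) le_rfl (by lia) (by lia)
    (by decide) (by decide) (fun s t hst _ => hst.ne)
    (fun y hy hyn => hbd t y ht htnk hy (by lia)) fun y τ₂ hy hyn hentry hτ₂ hrest => ?_).mono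
    fun σ' ⟨hdone, hrest⟩ x y hx hy hyn => ?_
  · have hrow₂ : τ₂ Reg.row 0 0 = t := by rw [hτ₂ _ (by decide), hτ₁ _ (by decide), hrow]
    refine ⟨hrow₂, hentry, ?_⟩
    simp only [Expr.eval_sub, Expr.eval_mul, Expr.eval_read, Expr.eval_const, eval_var,
      eval_tabEntry, hrow₂, hentry]
    rw [hrest t y fun s _ hs _ => hs.ne, hτ₁ _ (by decide), hI_row y hy (by lia),
      hτ₂ Reg.factor (by decide), hfactor, hτ₂ Reg.savedRow (by decide), hτ₁ _ (by decide),
      hτ Reg.savedRow (by decide)]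
  · obtain rfl | hne := eq_or_ne x t
    · rw [hdone y hy (by lia), if_pos (lt_add_one x)]
    · rw [hrest x y fun _ _ _ h => absurd h.symm hne, hτ₁ _ (by decide), hI x y hx hy hyn]
      exact if_congr (by lia) rfl rfl

theorem wp_eliminate (hd : Dims B k n σ) (hc : σ Reg.col 0 0 = (c : ℕ))
    (hi : σ Reg.pivot 0 0 = rowIndex i) (hA : ∀ r, HoldsRow (σ Reg.tab) N w r)
    (hN : |N i c| ≤ 1) (hmat : ∀ r a, |pivotMat N c i r a| ≤ 1)
    (hvec : ∀ r, |pivotVec N c i w r| ≤ B.size) :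
    WP B eliminate (fun σ' =>
      ∀ r, HoldsRow (σ' Reg.tab) (pivotMat N c i) (pivotVec N c i w) r) σ := by
  refine WP.seq (wp_saveRow hd hc hi (hA i) hN) fun τ hτ ⟨hrow, hrow_n⟩ => ?_
  have htab : τ Reg.tab = σ Reg.tab := hτ _ (by decide)
  have hmat_eq (r : Fin n ⊕ Fin k) (a : Fin n) : τ Reg.tab (rowIndex r) (a : ℕ) -
      τ Reg.tab (rowIndex r) (c : ℕ) * τ Reg.savedRow 0 (a : ℕ) = pivotMat N c i r a := by
    rw [htab, (hA r).mat, (hA r).mat, hrow, pivotMat_apply]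
  have hvec_eq (r : Fin n ⊕ Fin k) : τ Reg.tab (rowIndex r) n -
      τ Reg.tab (rowIndex r) (c : ℕ) * τ Reg.savedRow 0 n = pivotVec N c i w r := by
    rw [htab, (hA r).vec, (hA r).mat, hrow_n, pivotVec_apply, mul_comm (N r c)]
  refine (wp_subtractRows (hd.frame hτ (by decide) (by decide)) (by rw [hτ _ (by decide), hc])
    fun x y hx hxk hy hyn => ?_).mono fun σ' h r => ⟨fun a => ?_, ?_⟩
  · obtain ⟨r, rfl⟩ := exists_rowIndex hx hxk
    obtain hlt | rfl := hyn.lt_or_eq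
    · obtain ⟨a, rfl⟩ := exists_fin_cast hy hlt
      rw [hmat_eq]
      exact (hmat r a).trans (by linarith [B.two_le_size])
    · rw [hvec_eq]
      exact hvec r
  · rw [h _ _ (rowIndex_nonneg r) (rowIndex_lt r) (by omega) (by omega), hmat_eq]
  · rw [h _ _ (rowIndex_nonneg r) (rowIndex_lt r) (by omega) le_rfl, hvec_eq]

theorem wp_saveVec (hd : Dims B k n σ) (hA : ∀ r, HoldsRow (σ Reg.tab) N w r) :
    WP B saveVec (fun σ' => ∀ r : Fin n ⊕ Fin k, σ' Reg.savedVec (rowIndex r) 0 = w r) σ := by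
  have hlt := hd.lt_loops
  refine WP.of_bounded fun hB => (WP.forLoop_store (l := 0) (fun t => t) (fun _ => 0)
    (fun t => σ Reg.tab t n) rfl hd.eval_tabRows le_rfl (by lia) (by lia) (by decide) (by decide)
    (fun s t hst h => absurd h hst.ne) (fun t _ _ => hB _ _ _)
    fun t τ _ _ hrow hτ _ => ⟨by rw [eval_var, hrow], rfl, ?_⟩).mono fun σ' h r => ?_
  · rw [eval_tabEntry, hrow, hτ Reg.cols (by decide), hd.cols, hτ _ (by decide)]
  · rw [h.1 _ (rowIndex_nonneg r) (rowIndex_lt r), (hA r).vec]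

theorem wp_restoreVec {u : Fin n ⊕ Fin k → ℤ} (hd : Dims B k n σ)
    (hA : ∀ r, HoldsRow (σ Reg.tab) N w r)
    (hu : ∀ r : Fin n ⊕ Fin k, σ Reg.savedVec (rowIndex r) 0 = u r) :
    WP B restoreVec (fun σ' => ∀ r, HoldsRow (σ' Reg.tab) N u r) σ := by
  have hlt := hd.lt_loops
  refine WP.of_bounded fun hB => (WP.forLoop_store (l := 0) (fun t => t) (fun _ => n)
    (fun t => σ Reg.savedVec t 0) rfl hd.eval_tabRows le_rfl (by lia) (by lia) (by decide)
    (by decide) (fun s t hst h => absurd h hst.ne) (fun t _ _ => hB _ _ _)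
    fun t τ _ _ hrow hτ _ => ⟨by rw [eval_var, hrow], ?_, ?_⟩).mono fun σ' h r => ⟨fun a => ?_, ?_⟩
  · rw [eval_var, hτ _ (by decide), hd.cols]
  · rw [Expr.eval_read, Expr.eval_const, eval_var, hrow, hτ _ (by decide)]
  · rw [h.2 _ _ fun _ _ _ _ => by omega, (hA r).mat]
  · rw [h.1 _ (rowIndex_nonneg r) (rowIndex_lt r), hu]

theorem eval_pivotCoeff (hd : Dims B k n σ) (hc : σ Reg.col 0 0 = (c : ℕ))
    (hi : σ Reg.pivot 0 0 = rowIndex i) (hA : HoldsRow (σ Reg.tab) N w i) :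
    (Expr.mul (tabEntry Reg.pivot Reg.col) (tabEntry Reg.pivot Reg.cols)).eval σ = N i c * w i := by
  simp only [Expr.eval_mul, eval_tabEntry, hi, hc, hd.cols, hA.mat, hA.vec]

theorem wp_chooseSign (hd : Dims B k n σ) (hc : σ Reg.col 0 0 = (c : ℕ))
    (hi : σ Reg.pivot 0 0 = rowIndex i) (hA : HoldsRow (σ Reg.tab) N w i) :
    WP B chooseSign (fun σ' => ∃ g : ℤ, |g| = 1 ∧ 0 ≤ g * (N i c * w i) ∧
      σ' Reg.factor 0 0 = g) σ := by
  have hcoeff := eval_pivotCoeff hd hc hi hA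
  have hsize := B.two_le_size
  refine WP.ite (fun h => WP.assign ?_ ⟨1, abs_one, ?_, rfl⟩)
    fun h => WP.assign ?_ ⟨-1, by simp, ?_, rfl⟩
  all_goals simp only [hcoeff, Expr.eval_const, abs_one, abs_neg] at h ⊢; lia

theorem wp_emitVector {g : ℤ} (hd : Dims B k n σ) (hround : σ Reg.round 0 0 = (c : ℕ))
    (hc : σ Reg.col 0 0 = (c : ℕ)) (hg : σ Reg.factor 0 0 = g) (hg_abs : |g| = 1)
    (hA : ∀ r, HoldsRow (σ Reg.tab) N w r) :
    WP B emitVector (fun σ' =>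
      (∀ j : Fin n, σ' Reg.vectors (c : ℕ) (j : ℕ) = g * N (.inl j) c) ∧
        ∀ q : ℤ, q ≠ (c : ℕ) → σ' Reg.vectors q = σ Reg.vectors q) σ := by
  have hlt := hd.lt_loops
  refine WP.of_bounded fun hB => (WP.forLoop_store (l := 0) (fun _ => (c : ℕ)) (fun t => t)
    (fun t => g * σ Reg.tab t (c : ℕ)) rfl
    (by rw [eval_var, hd.cols]) le_rfl (by lia) (by lia) (by decide) (by decide)
    (fun s t hst _ => hst.ne) (fun t _ _ => ?_)
    fun t τ _ _ ht hτ _ => ⟨?_, by rw [eval_var, ht], ?_⟩).mono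
    fun σ' h => ⟨fun j => ?_, fun q hq => funext fun y => h.2 _ _ fun _ _ _ h => absurd h.symm hq⟩
  · rw [abs_mul, hg_abs, one_mul]
    exact hB _ _ _
  · rw [eval_var, hτ _ (by decide), hround]
  · rw [Expr.eval_mul, eval_var, eval_tabEntry, ht, hτ _ (by decide), hτ Reg.col (by decide),
      hτ _ (by decide), hg, hc]
  · rw [h.1 j (by omega) (by omega), ← (hA (.inl j)).mat]
    rfl

theorem wp_emit (hd : Dims B k n σ) (hround : σ Reg.round 0 0 = (c : ℕ))
    (hc : σ Reg.col 0 0 = (c : ℕ)) (hi : σ Reg.pivot 0 0 = rowIndex i)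
    (hA : ∀ r, HoldsRow (σ Reg.tab) N w r) (hN : |N i c| ≤ 1) :
    WP B emit (fun σ' => ∃ g : ℤ, |g| = 1 ∧ 0 ≤ g * (N i c * w i) ∧
      σ' Reg.coeffs (c : ℕ) 0 = g * (N i c * w i) ∧
      (∀ j : Fin n, σ' Reg.vectors (c : ℕ) (j : ℕ) = g * N (.inl j) c) ∧
      ∀ q : ℤ, q ≠ (c : ℕ) →
        σ' Reg.coeffs q 0 = σ Reg.coeffs q 0 ∧ σ' Reg.vectors q = σ Reg.vectors q) σ := by
  refine WP.of_bounded fun hB => WP.seq (wp_chooseSign hd hc hi (hA i))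
    fun τ hτ ⟨g, hg, hnonneg, hfactor⟩ => ?_
  have hcoeff : (Expr.mul (var Reg.factor) (.mul (tabEntry Reg.pivot Reg.col)
      (tabEntry Reg.pivot Reg.cols))).eval τ = g * (N i c * w i) := by
    rw [Expr.eval_mul, eval_var, hfactor, hτ.eval_eq (by decide), eval_pivotCoeff hd hc hi (hA i)]
  refine WP.seq (Q' := fun τ' => τ' Reg.coeffs (c : ℕ) 0 = g * (N i c * w i) ∧
    ∀ q : ℤ, q ≠ (c : ℕ) → τ' Reg.coeffs q 0 = σ Reg.coeffs q 0) (WP.store ?_ ?_)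
    fun τ' hτ' ⟨hcoeffs, hcoeffs_ne⟩ => ?_
  · rw [hcoeff, abs_mul, hg, one_mul, abs_mul, ← (hA i).vec]
    exact (mul_le_of_le_one_left (abs_nonneg _) hN).trans (hB _ _ _)
  · rw [hcoeff, eval_var, hτ _ (by decide), hround]
    refine ⟨Mem.write_same .., fun q hq => ?_⟩
    rw [Mem.write_apply, if_neg fun h => hq h.1, hτ _ (by decide)]
  · have hστ' := hτ.append hτ'
    refine (wp_emitVector (N := N) (c := c) (w := w) (hd.frame hστ' (by decide) (by decide))
      (by rw [hστ' _ (by decide), hround]) (by rw [hστ' _ (by decide), hc])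
      (by rw [hτ' _ (by decide), hfactor]) hg
      (by rwa [hστ' _ (by decide)])).mono_agreeOff fun σ' hσ' ⟨hvectors, hvectors_ne⟩ => ?_
    rw [hσ' Reg.coeffs (by decide)]
    refine ⟨g, hg, hnonneg, hcoeffs, hvectors, fun q hq => ⟨hcoeffs_ne q hq, ?_⟩⟩
    rw [hvectors_ne q hq, hστ' _ (by decide)]

end Pivot

/-! ### Correctness of the rounds -/

/-- The columns before position `t`. -/
def colsBelow (n : ℕ) (t : ℤ) : Finset (Fin n) := {a | ((a : ℕ) : ℤ) < t}

@[simp] theorem mem_colsBelow {n : ℕ} {t : ℤ} {a : Fin n} :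
    a ∈ colsBelow n t ↔ ((a : ℕ) : ℤ) < t := by
  simp [colsBelow]

theorem notMem_colsBelow_self {n : ℕ} (p : Fin n) : p ∉ colsBelow n (p : ℕ) := by simp

theorem insert_colsBelow {n : ℕ} (p : Fin n) :
    insert p (colsBelow n (p : ℕ)) = colsBelow n ((p : ℕ) + 1) := by
  ext a
  simp only [Finset.mem_insert, mem_colsBelow, Fin.ext_iff]
  omega

theorem colsBelow_zero (n : ℕ) : colsBelow n 0 = ∅ := by
  ext a
  simp

theorem colsBelow_eq_univ (n : ℕ) : colsBelow n n = Finset.univ := by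
  ext a
  simp

section Rounds

variable {B : Budget} {k n : ℕ} {σ : Mem} {M N : Matrix (Fin n ⊕ Fin k) (Fin n) ℤ}
  {T : Matrix (Fin k) (Fin n) ℤ} {R : Fin n → Fin n ⊕ Fin k} {U : ℤ} {u u₀ : Fin n ⊕ Fin k → ℤ}
  {p : Fin n}

theorem wp_reduceCols (hd : Dims B k n σ) (hM : M.IsTotallyUnimodular)
    (hround : σ Reg.round 0 0 = (p : ℕ)) (hU : n * U ≤ B.size)
    (h : Reduced M U (colsBelow n (p : ℕ)) R N u) (hA : ∀ r, HoldsRow (σ Reg.tab) N u r) :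
    WP B reduceCols (fun σ' => ∃ R N w,
      RoundReduced M U (colsBelow n (p : ℕ)) p u Finset.univ R N w ∧
        ∀ r, HoldsRow (σ' Reg.tab) N w r) σ := by
  have hlt := hd.lt_loops
  rw [← colsBelow_eq_univ]
  refine WP.forLoop_array (l := (p : ℕ) + 1) (fun t A => ∃ R N w,
      RoundReduced M U (colsBelow n (p : ℕ)) p u (colsBelow n t) R N w ∧ ∀ r, HoldsRow A N w r)
    (by rw [Expr.eval_add, eval_var, hround, Expr.eval_const]) hd.cols (by omega) (by omega)
    (by omega) (by decide) (by decide) (by decide)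
    ⟨R, N, u, insert_colsBelow p ▸ h.startRound p, hA⟩ ?_
  intro t τ htp htn hcol hτ ⟨R, N, w, hred, hA⟩
  obtain ⟨c, rfl⟩ := exists_fin_cast (by omega) htn
  have htab := hred.reduced.tableau
  have hdτ := hd.frame hτ (by decide) (by decide)
  refine WP.seq (wp_searchRow hdτ hcol hA (htab.exists_ne_zero c)) fun τ' hτ' ⟨i, hpivot, hi⟩ => ?_
  have hred' := hred.pivot hM (by simpa using by omega) (by rintro rfl; omega) hi
  have htab' := hred'.reduced.tableau
  rw [insert_colsBelow] at hred'
  refine (wp_eliminate (hdτ.frame hτ' (by decide) (by decide)) (by rw [hτ' _ (by decide), hcol])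
    hpivot (by rwa [hτ' _ (by decide)]) (htab.abs_apply_le_one hM i c) (htab'.abs_apply_le_one hM)
    fun r => ?_).mono fun σ' hA' => ⟨_, _, _, hred', hA'⟩
  exact (htab'.abs_le_card_mul hM hred'.mem_range hred'.abs_basis_le r).trans (by simpa using hU)

theorem wp_reduceRound (hd : Dims B k n σ) (hM : M.IsTotallyUnimodular)
    (hround : σ Reg.round 0 0 = (p : ℕ)) (hU : n * U ≤ B.size)
    (h : Reduced M U (colsBelow n (p : ℕ)) R N u) (hA : ∀ r, HoldsRow (σ Reg.tab) N u r) :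
    WP B reduceRound (fun σ' => ∃ R N, Reduced M U (colsBelow n (p : ℕ)) R N u ∧
      (∀ j, SignConform (N j p * u (R p)) (u j)) ∧ ∀ r, HoldsRow (σ' Reg.tab) N u r) σ := by
  refine WP.seq (wp_saveVec hd hA) fun τ₁ hτ₁ hsaved => ?_
  have hd₁ := hd.frame hτ₁ (by decide) (by decide)
  refine WP.seq (wp_reduceCols hd₁ hM (by rw [hτ₁ _ (by decide), hround]) hU h
    (by rwa [hτ₁ _ (by decide)])) fun τ₂ hτ₂ ⟨R', N', w, hred, hA'⟩ => ?_
  exact (wp_restoreVec (hd₁.frame hτ₂ (by decide) (by decide)) hA'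
    (by rwa [hτ₂ _ (by decide)])).mono fun σ' hA'' =>
      ⟨R', N', hred.reduced, hred.signConform_col, hA''⟩

/-- The terms with the coefficients and vectors in memory split off from `u₀` the vector `u`. -/
def MemDecomposition (T : Matrix (Fin k) (Fin n) ℤ) (u₀ : Fin n ⊕ Fin k → ℤ) (S : Finset (Fin n))
    (u : Fin n ⊕ Fin k → ℤ) (σ : Mem) : Prop :=
  PartialDecomposition T u₀ S (fun q => σ Reg.coeffs (q : ℕ) 0)
    (fun q j => σ Reg.vectors (q : ℕ) (j : ℕ)) u

theorem MemDecomposition.frame {S : Finset (Fin n)} {L : List ℕ} {τ : Mem}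
    (h : MemDecomposition T u₀ S u σ) (hτ : AgreeOff L σ τ) (hcoeffs : Reg.coeffs ∉ L)
    (hvectors : Reg.vectors ∉ L) : MemDecomposition T u₀ S u τ := by
  rwa [MemDecomposition, hτ _ hcoeffs, hτ _ hvectors]

theorem wp_emit_memDecomposition {i : Fin n ⊕ Fin k} (hd : Dims B k n σ)
    (hT : T.IsTotallyUnimodular) (hround : σ Reg.round 0 0 = (p : ℕ))
    (hcol : σ Reg.col 0 0 = (p : ℕ)) (hpivot : σ Reg.pivot 0 0 = rowIndex i)
    (hA : ∀ r, HoldsRow (σ Reg.tab) N u r)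
    (hred : Reduced (stacked T) U (colsBelow n (p : ℕ)) R N u)
    (hconf : ∀ j, SignConform (N j p * u (R p)) (u j)) (hi : IsRatioRow N u p i)
    (hdec : MemDecomposition T u₀ (colsBelow n (p : ℕ)) u σ) :
    WP B emit (MemDecomposition T u₀ (colsBelow n ((p : ℕ) + 1)) (pivotVec N p i u)) σ := by
  have hN := hred.tableau.abs_apply_le_one (isTotallyUnimodular_stacked hT) i p
  refine (wp_emit hd hround hcol hpivot hA hN).mono
    fun σ' ⟨g, hg, hnonneg, hcoeff, hvector, hrest⟩ => ?_
  have hne {q : Fin n} (hq : q ∈ colsBelow n (p : ℕ)) : ((q : ℕ) : ℤ) ≠ (p : ℕ) :=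
    (mem_colsBelow.mp hq).ne
  rw [← insert_colsBelow]
  exact (PartialDecomposition.congr hdec (fun q hq => (hrest _ (hne hq)).1) fun q hq => by
    rw [(hrest _ (hne hq)).2]).pivot hT hred (notMem_colsBelow_self p) hconf hi hg hcoeff
      (hcoeff ▸ hnonneg) (funext hvector)

/-- The invariant of the main loop, before the round for column `t`. -/
def RoundInv (T : Matrix (Fin k) (Fin n) ℤ) (U : ℤ) (u₀ : Fin n ⊕ Fin k → ℤ) (t : ℤ) (σ : Mem) :
    Prop :=
  ∃ R N u, Reduced (stacked T) U (colsBelow n t) R N u ∧ (∀ r, HoldsRow (σ Reg.tab) N u r) ∧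
    MemDecomposition T u₀ (colsBelow n t) u σ

theorem wp_splitColumn (hd : Dims B k n σ) (hT : T.IsTotallyUnimodular)
    (hround : σ Reg.round 0 0 = (p : ℕ)) (hU : n * U ≤ B.size)
    (hred : Reduced (stacked T) U (colsBelow n (p : ℕ)) R N u)
    (hconf : ∀ j, SignConform (N j p * u (R p)) (u j)) (hA : ∀ r, HoldsRow (σ Reg.tab) N u r)
    (hdec : MemDecomposition T u₀ (colsBelow n (p : ℕ)) u σ) :
    WP B splitColumn (RoundInv T U u₀ ((p : ℕ) + 1)) σ := by
  have hM := isTotallyUnimodular_stacked hT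
  refine WP.seq (Q' := fun τ => τ Reg.col 0 0 = (p : ℕ))
    (WP.of_bounded fun hB => WP.assign (hB _ _ _) (by rw [Mem.write_same, eval_var, hround]))
    fun τ₁ hτ₁ hcol => ?_
  have hd₁ := hd.frame hτ₁ (by decide) (by decide)
  have hA₁ : ∀ r, HoldsRow (τ₁ Reg.tab) N u r := by rwa [hτ₁ _ (by decide)]
  refine WP.seq (wp_searchRow hd₁ hcol hA₁ (hred.tableau.exists_ne_zero p))
    fun τ₂ hτ₂ ⟨i, hpivot, hi⟩ => ?_
  have hd₂ := hd₁.frame hτ₂ (by decide) (by decide)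
  have hcol₂ : τ₂ Reg.col 0 0 = (p : ℕ) := by rw [hτ₂ _ (by decide), hcol]
  have hA₂ : ∀ r, HoldsRow (τ₂ Reg.tab) N u r := by rwa [hτ₂ _ (by decide)]
  have hστ₂ := hτ₁.append hτ₂
  refine WP.seq (wp_emit_memDecomposition hd₂ hT (by rw [hστ₂ _ (by decide), hround]) hcol₂ hpivot
    hA₂ hred hconf hi (hdec.frame hστ₂ (by decide) (by decide))) fun τ₃ hτ₃ hdec' => ?_
  have hred' := hred.pivot hM hconf hi
  rw [insert_colsBelow] at hred'
  refine (wp_eliminate (hd₂.frame hτ₃ (by decide) (by decide)) (by rw [hτ₃ _ (by decide), hcol₂])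
    (by rw [hτ₃ _ (by decide), hpivot]) (by rwa [hτ₃ _ (by decide)])
    (hred.tableau.abs_apply_le_one hM i p) (hred'.tableau.abs_apply_le_one hM)
    fun r => ?_).mono_agreeOff fun σ' hσ' hA' =>
      ⟨_, _, _, hred', hA', hdec'.frame hσ' (by decide) (by decide)⟩
  exact (hred'.tableau.abs_le_card_mul hM hred'.mem_range (fun a => hred'.abs_le _) r).trans
    (by simpa using hU)

theorem wp_round (hd : Dims B k n σ) (hT : T.IsTotallyUnimodular)
    (hround : σ Reg.round 0 0 = (p : ℕ)) (hU : n * U ≤ B.size) (h : RoundInv T U u₀ (p : ℕ) σ) :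
    WP B (.seq reduceRound splitColumn) (RoundInv T U u₀ ((p : ℕ) + 1)) σ := by
  obtain ⟨R, N, u, hred, hA, hdec⟩ := h
  refine WP.seq (wp_reduceRound hd (isTotallyUnimodular_stacked hT) hround hU hred hA)
    fun τ hτ ⟨R', N', hred', hconf, hA'⟩ => ?_
  exact wp_splitColumn (hd.frame hτ (by decide) (by decide)) hT (by rw [hτ _ (by decide), hround])
    hU hred' hconf hA' (hdec.frame hτ (by decide) (by decide))

end Rounds

/-! ### Correctness of the initialization -/

/-- The arrays `matrix`, `source` and `target` hold `T`, `x₀` and `y`. -/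
structure HoldsInput {k n : ℕ} (T : Matrix (Fin k) (Fin n) ℤ) (x₀ y : Fin n → ℤ) (σ : Mem) :
    Prop where
  mat : ∀ (i : Fin k) (j : Fin n), σ Reg.matrix (i : ℕ) (j : ℕ) = T i j
  source : ∀ j : Fin n, σ Reg.source (j : ℕ) 0 = x₀ j
  target : ∀ j : Fin n, σ Reg.target (j : ℕ) 0 = y j

theorem HoldsInput.frame {k n : ℕ} {T : Matrix (Fin k) (Fin n) ℤ} {x₀ y : Fin n → ℤ} {σ σ' : Mem}
    {S : List ℕ} (h : HoldsInput T x₀ y σ) (hf : AgreeOff S σ σ') (hmat : Reg.matrix ∉ S)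
    (hsource : Reg.source ∉ S) (htarget : Reg.target ∉ S) : HoldsInput T x₀ y σ' :=
  ⟨fun i j => by rw [hf _ hmat, h.mat], fun j => by rw [hf _ hsource, h.source],
    fun j => by rw [hf _ htarget, h.target]⟩

section Init

variable {B : Budget} {k n : ℕ} {σ : Mem} {T : Matrix (Fin k) (Fin n) ℤ} {x₀ y : Fin n → ℤ}
  {Z : ℤ} {i : Fin k}

theorem wp_initUnits (hd : Dims B k n σ) (h0 : ∀ x y, σ Reg.tab x y = 0) :
    WP B initUnits (fun σ' => ∀ x y : ℤ,
      σ' Reg.tab x y = if 0 ≤ x ∧ x < n ∧ x = y then 1 else 0) σ := by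
  have hlt := hd.lt_loops
  have hsize := B.two_le_size
  refine (WP.forLoop_store (l := 0) (h := n) (fun t => t) (fun t => t) (fun _ => 1) rfl
    (by rw [eval_var, hd.cols]) le_rfl (by lia) (by lia) (by decide) (by decide)
    (fun s t hst h => absurd h hst.ne) (fun t _ _ => by rw [abs_one]; lia)
    fun t τ _ _ ht _ _ => ⟨by rw [eval_var, ht], by rw [eval_var, ht], rfl⟩).mono
    fun σ' ⟨hdone, hrest⟩ x y => ?_
  split_ifs with h
  · obtain ⟨hx, hxn, rfl⟩ := h
    exact hdone x hx hxn
  · rw [hrest x y fun t ht htn htx hty => h ⟨htx ▸ ht, htx ▸ htn, htx.symm.trans hty⟩, h0]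

theorem wp_initDiff (hd : Dims B k n σ) (hin : HoldsInput T x₀ y σ)
    (hunits : ∀ x y : ℤ, σ Reg.tab x y = if 0 ≤ x ∧ x < n ∧ x = y then 1 else 0)
    (hZ : ∀ j, |y j - x₀ j| ≤ B.size) :
    WP B initDiff (fun σ' =>
      (∀ j, HoldsRow (σ' Reg.tab) (stacked T) (stacked T *ᵥ (y - x₀)) (.inl j)) ∧
        ∀ i : Fin k, σ' Reg.tab (rowIndex (n := n) (.inr i)) n = 0) σ := by
  have hlt := hd.lt_loops
  refine (WP.forLoop_store (l := 0) (h := n) (fun t => t) (fun _ => n)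
    (fun t => σ Reg.target t 0 - σ Reg.source t 0) rfl
    (by rw [eval_var, hd.cols]) le_rfl (by lia) (by lia) (by decide) (by decide)
    (fun s t hst h => absurd h hst.ne) (fun t ht htn => ?_)
    fun t τ _ _ ht hτ _ => ⟨by rw [eval_var, ht], ?_, ?_⟩).mono
    fun σ' ⟨hdone, hrest⟩ => ⟨fun j => ⟨fun c => ?_, ?_⟩, fun i => ?_⟩
  · obtain ⟨j, rfl⟩ := exists_fin_cast ht htn
    rw [hin.target, hin.source]
    exact hZ j
  · rw [eval_var, hτ _ (by decide), hd.cols]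
  · simp only [Expr.eval_sub, Expr.eval_read, Expr.eval_const, eval_var, ht]
    rw [hτ _ (by decide), hτ _ (by decide)]
  · rw [hrest _ _ fun _ _ _ _ => by omega, hunits]
    simp [rowIndex, stacked, Matrix.one_apply, Fin.ext_iff]
  · rw [rowIndex, hdone _ (by omega) (by omega), hin.target, hin.source, stacked_mulVec_inl]
    rfl
  · rw [hrest _ _ fun t _ htn h => absurd h (by simp only [rowIndex]; omega), hunits,
      if_neg (by simp only [rowIndex]; omega)]

theorem wp_copyRow (hd : Dims B k n σ) (hin : HoldsInput T x₀ y σ)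
    (hrow : σ Reg.row 0 0 = (i : ℕ)) :
    WP B copyRow (fun σ' =>
      (∀ j : Fin n, σ' Reg.tab (rowIndex (n := n) (.inr i)) (j : ℕ) = T i j) ∧
        ∀ x y : ℤ, (x = rowIndex (n := n) (.inr i) → y = n) →
          σ' Reg.tab x y = σ Reg.tab x y) σ := by
  have hlt := hd.lt_loops
  refine WP.of_bounded fun hB => (WP.forLoop_store (l := 0) (h := n)
    (fun _ => rowIndex (n := n) (.inr i)) (fun t => t) (fun t => σ Reg.matrix (i : ℕ) t) rfl
    (by rw [eval_var, hd.cols]) le_rfl (by lia) (by lia) (by decide) (by decide)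
    (fun s t hst _ => hst.ne) (fun t _ _ => hB _ _ _)
    fun t τ _ _ ht hτ _ => ⟨?_, by rw [eval_var, ht], ?_⟩).mono
    fun σ' ⟨hdone, hrest⟩ => ⟨fun j => ?_, fun x y hxy => hrest x y fun t _ htn hx hy => ?_⟩
  · rw [Expr.eval_add, eval_var, eval_var, hτ _ (by decide), hτ _ (by decide), hd.cols, hrow]
    rfl
  · rw [Expr.eval_read, eval_var, eval_var, ht, hτ _ (by decide), hτ _ (by decide), hrow]
  · rw [hdone _ (by omega) (by omega), hin.mat]
  · exact absurd (hy.trans (hxy hx.symm)) htn.ne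

theorem wp_dotRow (hd : Dims B k n σ) (hin : HoldsInput T x₀ y σ) (hT : T.IsTotallyUnimodular)
    (hrow : σ Reg.row 0 0 = (i : ℕ)) (h0 : σ Reg.tab (rowIndex (n := n) (.inr i)) n = 0)
    {d : Fin n → ℤ} (hd' : ∀ j : Fin n, σ Reg.tab (j : ℕ) n = d j) (hZ : ∀ j, |d j| ≤ Z)
    (hsize : n * Z ≤ B.size) :
    WP B dotRow (fun σ' => σ' Reg.tab (rowIndex (n := n) (.inr i)) n = (T *ᵥ d) i ∧
        ∀ x y : ℤ, (x = rowIndex (n := n) (.inr i) → y ≠ n) →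
          σ' Reg.tab x y = σ Reg.tab x y) σ := by
  have hlt := hd.lt_loops
  refine (WP.forLoop_array (l := 0) (h := n) (a := Reg.tab) (fun t A =>
      A (rowIndex (n := n) (.inr i)) n = ∑ a ∈ colsBelow n t, T i a * d a ∧
      ∀ x y : ℤ, (x = rowIndex (n := n) (.inr i) → y ≠ n) → A x y = σ Reg.tab x y)
    rfl (by rw [eval_var, hd.cols]) le_rfl (by lia) (by lia) (by decide) (by decide) (by decide)
    ⟨by rw [colsBelow_zero, h0, Finset.sum_empty], fun _ _ _ => rfl⟩ ?_).mono
    fun σ' ⟨hsum, hrest⟩ => ⟨by rw [hsum, colsBelow_eq_univ]; rfl, hrest⟩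
  intro t τ ht htn hentry hτ ⟨hsum, hrest⟩
  obtain ⟨j, rfl⟩ := exists_fin_cast ht htn
  have hj : τ Reg.tab (j : ℕ) n = d j := by
    rw [hrest _ _ fun h => absurd h (by simp only [rowIndex]; omega), hd']
  have hpos : (Expr.add (var Reg.cols) (var Reg.row)).eval τ = rowIndex (n := n) (.inr i) := by
    rw [hτ.eval_eq (by decide), Expr.eval_add, eval_var, eval_var, hd.cols, hrow]
    rfl
  have hval : (Expr.add (.read Reg.tab (.add (var Reg.cols) (var Reg.row)) (var Reg.cols))
      (.mul (.read Reg.matrix (var Reg.row) (var Reg.entry))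
        (tabEntry Reg.entry Reg.cols))).eval τ = ∑ a ∈ colsBelow n ((j : ℕ) + 1), T i a * d a := by
    rw [Expr.eval_add, Expr.eval_read, hpos, Expr.eval_mul, Expr.eval_read, eval_tabEntry, eval_var,
      eval_var, eval_var, hentry, hτ Reg.cols (by decide), hd.cols, hτ Reg.row (by decide), hrow,
      hτ Reg.matrix (by decide), hin.mat, hj, hsum, ← insert_colsBelow,
      Finset.sum_insert (notMem_colsBelow_self j), add_comm]
  refine WP.store ?_ ?_
  · rw [hval]
    refine (abs_sum_mul_le_card_mul _ (fun a => ?_) hZ).trans (by simpa using hsize)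
    exact (isTableau_stacked T).abs_apply_le_one (isTotallyUnimodular_stacked hT) (.inr i) a
  · rw [hval, hpos, eval_var, hτ Reg.cols (by decide), hd.cols]
    refine ⟨Mem.write_same .., fun x y hxy => ?_⟩
    rw [Mem.write_apply, if_neg fun h => hxy h.1 h.2, hrest x y hxy]

/-- The invariant of the row loop of `initTab`, before the pass for row `t` of `T`. -/
structure InitInv {k n : ℕ} (T : Matrix (Fin k) (Fin n) ℤ) (u₀ : Fin n ⊕ Fin k → ℤ) (t : ℤ)
    (A : ℤ → ℤ → ℤ) : Prop where
  holdsRow : ∀ r, rowIndex r < n + t → HoldsRow A (stacked T) u₀ r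
  eq_zero : ∀ i : Fin k, t ≤ (i : ℕ) → A (rowIndex (n := n) (.inr i)) n = 0

theorem wp_initRow (hd : Dims B k n σ) (hin : HoldsInput T x₀ y σ) (hT : T.IsTotallyUnimodular)
    (hrow : σ Reg.row 0 0 = (i : ℕ)) (hZ : ∀ j, |y j - x₀ j| ≤ Z) (hsize : n * Z ≤ B.size)
    (h : InitInv T (stacked T *ᵥ (y - x₀)) (i : ℕ) (σ Reg.tab)) :
    WP B (.seq copyRow dotRow)
      (fun σ' => InitInv T (stacked T *ᵥ (y - x₀)) ((i : ℕ) + 1) (σ' Reg.tab)) σ := by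
  refine WP.seq (wp_copyRow hd hin hrow) fun τ hτ ⟨hcopy, hrest⟩ => ?_
  have hdiff : ∀ j : Fin n, τ Reg.tab (j : ℕ) n = (y - x₀) j := fun j => by
    rw [hrest _ _ fun _ => rfl, ← stacked_mulVec_inl T (y - x₀) j]
    exact (h.holdsRow (.inl j) (by simp only [rowIndex]; omega)).vec
  refine (wp_dotRow (i := i) (hd.frame hτ (by decide) (by decide))
    (hin.frame hτ (by decide) (by decide) (by decide)) hT (by rw [hτ _ (by decide), hrow])
    (by rw [hrest _ _ fun _ => rfl, h.eq_zero i le_rfl]) hdiff hZ hsize).mono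
    fun ρ ⟨hdot, hrest'⟩ => ⟨fun r hr => ?_, fun l hl => ?_⟩
  · obtain rfl | hne := eq_or_ne r (.inr i)
    · refine ⟨fun c => ?_, by rw [hdot, stacked_mulVec_inr]⟩
      rw [hrest' _ _ fun _ => by omega, hcopy]
      rfl
    · have hpos : rowIndex r ≠ rowIndex (.inr i) := rowIndex_injective.ne hne
      have hold := h.holdsRow r (by simp only [rowIndex] at hpos hr ⊢; omega)
      exact ⟨fun c => by rw [hrest' _ _ (absurd · hpos), hrest _ _ (absurd · hpos), hold.mat],
        by rw [hrest' _ _ (absurd · hpos), hrest _ _ (absurd · hpos), hold.vec]⟩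
  · have hpos : rowIndex (n := n) (.inr l) ≠ rowIndex (n := n) (.inr i) := by
      simp only [rowIndex]
      omega
    rw [hrest' _ _ (absurd · hpos), hrest _ _ (absurd · hpos), h.eq_zero l (by omega)]

theorem wp_initTab (hd : Dims B k n σ) (hin : HoldsInput T x₀ y σ) (hT : T.IsTotallyUnimodular)
    (h0 : ∀ x y, σ Reg.tab x y = 0) (hZ : ∀ j, |y j - x₀ j| ≤ Z) (hsize : n * Z ≤ B.size) :
    WP B initTab
      (fun σ' => ∀ r, HoldsRow (σ' Reg.tab) (stacked T) (stacked T *ᵥ (y - x₀)) r) σ := by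
  have hlt := hd.lt_loops
  have hZ' : ∀ j, |y j - x₀ j| ≤ B.size := fun j => by
    have hn : (1 : ℤ) ≤ n := by have := j.isLt; omega
    exact (hZ j).trans ((le_mul_of_one_le_left ((abs_nonneg _).trans (hZ j)) hn).trans hsize)
  refine WP.seq (wp_initUnits hd h0) fun σ₁ hσ₁ hunits => ?_
  have hd₁ := hd.frame hσ₁ (by decide) (by decide)
  have hin₁ := hin.frame hσ₁ (by decide) (by decide) (by decide)
  refine WP.seq (wp_initDiff hd₁ hin₁ hunits hZ') fun σ₂ hσ₂ ⟨hrows, hzero⟩ => ?_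
  have hd₂ := hd₁.frame hσ₂ (by decide) (by decide)
  have hin₂ := hin₁.frame hσ₂ (by decide) (by decide) (by decide)
  refine (WP.forLoop_array (l := 0) (h := k) (a := Reg.tab) (InitInv T (stacked T *ᵥ (y - x₀))) rfl
    (by rw [eval_var, hd₂.rows]) le_rfl (by lia) (by lia) (by decide) (by decide) (by decide)
    ⟨fun r hr => ?_, fun i _ => hzero i⟩ fun t τ ht htk hrow hτ hinv => ?_).mono
    fun σ' h r => h.holdsRow r (rowIndex_lt r)
  · cases r with
    | inl j => exact hrows j
    | inr i => exact absurd hr (by simp only [rowIndex]; omega)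
  · obtain ⟨i, rfl⟩ := exists_fin_cast ht htk
    exact wp_initRow (hd₂.frame hτ (by decide) (by decide))
      (hin₂.frame hτ (by decide) (by decide) (by decide)) hT hrow hZ hsize hinv

end Init

/-! ### The decomposition algorithm -/

section Decompose

variable {B : Budget} {k n : ℕ} {σ : Mem} {T : Matrix (Fin k) (Fin n) ℤ} {b : Fin k → ℤ}
  {x₀ y : Fin n → ℤ} {U Z : ℤ} {u₀ : Fin n ⊕ Fin k → ℤ}

theorem roundInv_zero {d : Fin n → ℤ} (hT : T.IsTotallyUnimodular) (hZ : ∀ j, |d j| ≤ Z)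
    (h : ∀ r, HoldsRow (σ Reg.tab) (stacked T) (stacked T *ᵥ d) r) :
    RoundInv T (n * Z) (stacked T *ᵥ d) 0 σ := by
  refine ⟨Sum.inl, stacked T, stacked T *ᵥ d, ⟨isTableau_stacked T, ⟨d, rfl⟩, ?_, fun j => ?_⟩, h,
    ?_⟩
  · simp [colsBelow_zero]
  · simpa using (isTableau_stacked T).abs_le_card_mul (isTotallyUnimodular_stacked hT) ⟨d, rfl⟩
      (fun a => by simpa using hZ a) j
  · rw [colsBelow_zero]
    exact .empty ..

theorem RoundInv.write_round {t : ℤ} (h : RoundInv T U u₀ t σ) (v : ℤ) :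
    RoundInv T U u₀ t (σ.write Reg.round 0 0 v) := by
  obtain ⟨R, N, u, hred, hA, hdec⟩ := h
  refine ⟨R, N, u, hred, by rwa [Mem.write_of_ne _ (by decide)], ?_⟩
  exact hdec.frame (L := [Reg.round]) (fun a ha => Mem.write_of_ne _ (by simpa using ha) ..)
    (by decide) (by decide)

theorem RoundInv.isDecomposition (h : RoundInv T U (stacked T *ᵥ (y - x₀)) n σ)
    (hx : T *ᵥ x₀ ≤ b) (hy : T *ᵥ y ≤ b) :
    IsDecomposition T b x₀ y (fun i => σ Reg.coeffs (i : ℕ) 0)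
      (fun i j => σ Reg.vectors (i : ℕ) (j : ℕ)) := by
  obtain ⟨R, N, u, hred, -, hdec⟩ := h
  rw [colsBelow_eq_univ] at hred hdec
  obtain rfl := hred.eq_zero
  exact PartialDecomposition.isDecomposition hdec hx hy

theorem wp_decomposeProg (hd : Dims B k n σ) (hin : HoldsInput T x₀ y σ)
    (h0 : ∀ x y, σ Reg.tab x y = 0) (hT : T.IsTotallyUnimodular) (hx : T *ᵥ x₀ ≤ b)
    (hy : T *ᵥ y ≤ b) (hZ : ∀ j, |y j - x₀ j| ≤ Z) (hsize : n * (n * Z) ≤ B.size) :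
    WP B decomposeProg (fun σ' => IsDecomposition T b x₀ y
      (fun i => σ' Reg.coeffs (i : ℕ) 0) (fun i j => σ' Reg.vectors (i : ℕ) (j : ℕ))) σ := by
  have hlt := hd.lt_loops
  have hnZ : n * Z ≤ B.size := by
    obtain rfl | hn := n.eq_zero_or_pos
    · simpa using hsize
    · have hnonneg : 0 ≤ n * Z := mul_nonneg (by lia) ((abs_nonneg _).trans (hZ ⟨0, hn⟩))
      exact (le_mul_of_one_le_left hnonneg (by lia)).trans hsize
  refine WP.seq (wp_initTab hd hin hT h0 hZ hnZ) fun τ hτ hrows => ?_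
  have hd₁ := hd.frame hτ (by decide) (by decide)
  refine (WP.forLoop (l := 0) (h := n) (RoundInv T (n * Z) (stacked T *ᵥ (y - x₀))) rfl
    (by rw [eval_var, hd₁.cols]) le_rfl (by lia) (by lia) (by decide) (by decide)
    (roundInv_zero hT hZ hrows) (fun t ρ v h => h.write_round v)
    fun t ρ ht htn hround hρ hinv => ?_).mono fun σ' h => h.isDecomposition hx hy
  obtain ⟨p, rfl⟩ := exists_fin_cast ht htn
  exact wp_round (hd₁.frame hρ (by decide) (by decide)) hT hround hsize hinv

end Decompose

/-! ### The input -/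

theorem one_le_bitLength (z : ℤ) : 1 ≤ bitLength z := Nat.le_add_left ..

theorem bitLength_two_pow (m : ℕ) : bitLength (2 ^ m) = m + 2 := by
  simp [bitLength, Int.natAbs_pow, Nat.size_pow]

theorem abs_lt_two_pow_bitLength (z : ℤ) : |z| < 2 ^ bitLength z := by
  rw [Int.abs_eq_natAbs, bitLength]
  exact_mod_cast (Nat.lt_size_self _).trans (Nat.pow_lt_pow_succ one_lt_two)

section Input

variable {k n : ℕ} (T : Matrix (Fin k) (Fin n) ℤ) (b : Fin k → ℤ) (x₀ y : Fin n → ℤ)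

theorem arrayOf_apply (i : Fin k) (j : Fin n) : arrayOf T (i : ℕ) (j : ℕ) = T i j :=
  dif_pos ⟨i.isLt, j.isLt⟩

theorem arrayOf_replicateCol (i : Fin k) :
    arrayOf (Matrix.replicateCol (Fin 1) b) (i : ℕ) 0 = b i :=
  arrayOf_apply (Matrix.replicateCol (Fin 1) b) i 0

theorem bitLength_arrayOf_le {L : ℕ} (hL : 1 ≤ L) (h : ∀ i j, bitLength (T i j) ≤ L) (i j : ℤ) :
    bitLength (arrayOf T i j) ≤ L := by
  unfold arrayOf
  split
  · split_ifs
    · exact h _ _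
    · simpa [bitLength] using hL
  · simpa [bitLength] using hL

theorem bitLength_le_sum {m : ℕ} (v : Fin m → ℤ) (i : Fin m) :
    bitLength (v i) ≤ ∑ i, bitLength (v i) :=
  Finset.single_le_sum_of_canonicallyOrdered (f := fun i => bitLength (v i)) (Finset.mem_univ i)

theorem bitLength_inputMem_le (a : ℕ) (i j : ℤ) :
    bitLength (inputMem T b x₀ y a i j) ≤ inputLength T b x₀ y := by
  have hL : 1 ≤ inputLength T b x₀ y := by
    have := one_le_bitLength k
    unfold inputLength
    lia
  have hT : ∀ i j, bitLength (T i j) ≤ ∑ i, ∑ j, bitLength (T i j) := fun i j =>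
    (bitLength_le_sum (T i) j).trans (Finset.single_le_sum_of_canonicallyOrdered
      (f := fun i => ∑ j, bitLength (T i j)) (Finset.mem_univ i))
  unfold inputMem
  split <;> first
    | refine bitLength_arrayOf_le _ hL (fun i j => ?_) _ _
    | simpa [bitLength] using hL
  all_goals rw [inputLength]
  · rw [Matrix.replicateCol_apply]; lia
  · rw [Matrix.replicateCol_apply]; lia
  · have := hT i j; lia
  · have := bitLength_le_sum b i; rw [Matrix.replicateCol_apply]; lia
  · have := bitLength_le_sum x₀ i; rw [Matrix.replicateCol_apply]; lia
  · have := bitLength_le_sum y i; rw [Matrix.replicateCol_apply]; lia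

theorem abs_inputMem_lt (a : ℕ) (i j : ℤ) :
    |inputMem T b x₀ y a i j| < 2 ^ inputLength T b x₀ y :=
  (abs_lt_two_pow_bitLength _).trans_le
    (pow_le_pow_right₀ one_le_two (bitLength_inputMem_le T b x₀ y a i j))

theorem inputCount_le_inputLength : inputCount k n ≤ inputLength T b x₀ y := by
  calc inputCount k n
      = 1 + 1 + (∑ _ : Fin k, ∑ _ : Fin n, 1) + (∑ _ : Fin k, 1) + (∑ _ : Fin n, 1) +
          ∑ _ : Fin n, 1 := by simp [inputCount]
    _ ≤ inputLength T b x₀ y := by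
      unfold inputLength
      gcongr <;> exact one_le_bitLength _

theorem add_lt_inputCount (k n : ℕ) : n + k < inputCount k n := by
  unfold inputCount
  have := (k * n).zero_le
  lia

/-- The resources that suffice for the run on the input `(k, n, T, b, x₀, y)`: all numbers in
memory are at most `n² z`, where `z = 2 ^ (L + 1)` bounds the entries of `y - x₀` and `n ≤ 2 ^ L`
for the input length `L`. -/
def inputBudget : Budget where
  loops := inputCount k n
  size := 2 ^ (3 * inputLength T b x₀ y + 1)
  width := decomposeProg.width
  loops_add_two_le := by
    have hcount := inputCount_le_inputLength T b x₀ y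
    have hpow : 3 * inputLength T b x₀ y + 1 < 2 ^ (3 * inputLength T b x₀ y + 1) :=
      Nat.lt_two_pow_self
    exact_mod_cast (by lia : inputCount k n + 2 ≤ 2 ^ (3 * inputLength T b x₀ y + 1))

theorem dims_inputMem : Dims (inputBudget T b x₀ y) k n (inputMem T b x₀ y) :=
  ⟨arrayOf_replicateCol (fun _ : Fin 1 => (k : ℤ)) 0,
    arrayOf_replicateCol (fun _ : Fin 1 => (n : ℤ)) 0, add_lt_inputCount k n⟩

theorem holdsInput_inputMem : HoldsInput T x₀ y (inputMem T b x₀ y) :=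
  ⟨arrayOf_apply T, arrayOf_replicateCol x₀, arrayOf_replicateCol y⟩

theorem bounded_inputMem : Bounded (inputBudget T b x₀ y).size (inputMem T b x₀ y) := fun a i j =>
  (abs_inputMem_lt T b x₀ y a i j).le.trans (pow_le_pow_right₀ one_le_two (by lia))

theorem abs_sub_le_two_pow_inputLength (j : Fin n) :
    |y j - x₀ j| ≤ 2 ^ (inputLength T b x₀ y + 1) := by
  have hx := abs_inputMem_lt T b x₀ y Reg.source (j : ℕ) 0
  have hy := abs_inputMem_lt T b x₀ y Reg.target (j : ℕ) 0
  rw [(holdsInput_inputMem T b x₀ y).source] at hx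
  rw [(holdsInput_inputMem T b x₀ y).target] at hy
  calc |y j - x₀ j| ≤ |y j| + |x₀ j| := abs_sub ..
    _ ≤ 2 ^ inputLength T b x₀ y + 2 ^ inputLength T b x₀ y := by gcongr
    _ = 2 ^ (inputLength T b x₀ y + 1) := by ring

theorem card_mul_le_size_inputBudget :
    (n : ℤ) * (n * 2 ^ (inputLength T b x₀ y + 1)) ≤ (inputBudget T b x₀ y).size := by
  have hn : (n : ℤ) ≤ 2 ^ inputLength T b x₀ y := by
    simpa [(dims_inputMem T b x₀ y).cols] using
      (le_abs_self _).trans (abs_inputMem_lt T b x₀ y Reg.cols 0 0).le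
  calc (n : ℤ) * (n * 2 ^ (inputLength T b x₀ y + 1))
      ≤ 2 ^ inputLength T b x₀ y * (2 ^ inputLength T b x₀ y *
          2 ^ (inputLength T b x₀ y + 1)) := by gcongr
    _ = 2 ^ (3 * inputLength T b x₀ y + 1) := by ring

end Input

/-- Decomposition lemma. One program `P` computes, for every totally unimodular system `T x ≤ b` and
all integral solutions `x₀`, `y`, a decomposition of `y - x₀` (the coefficients in array `6`, the
vectors as the rows of array `7`). It is strongly polynomial: the number of elementary steps is
polynomial in the number of input integers, and all numbers that occur have encoding length
polynomial in that of the input. -/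
theorem lemma6 :
    ∃ (P : Prog) (p q : Polynomial ℕ),
      ∀ (k n : ℕ) (T : Matrix (Fin k) (Fin n) ℤ) (b : Fin k → ℤ) (x₀ y : Fin n → ℤ),
        T.IsTotallyUnimodular → T *ᵥ x₀ ≤ b → T *ᵥ y ≤ b →
        ∃ (t : ℕ) (σ : Mem),
          Exec (q.eval (inputLength T b x₀ y)) P (inputMem T b x₀ y) t σ ∧
          t ≤ p.eval (inputCount k n) ∧
          IsDecomposition T b x₀ y
            (fun i => σ 6 (i : ℕ) 0) (fun i j => σ 7 (i : ℕ) (j : ℕ)) := by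
  refine ⟨decomposeProg, decomposeProg.time,
    (3 * Polynomial.X + 1) * Polynomial.C decomposeProg.width + 2, ?_⟩
  intro k n T b x₀ y hT hx hy
  obtain ⟨t, σ, hexec, ht, -, hσ⟩ := wp_decomposeProg (dims_inputMem T b x₀ y)
    (holdsInput_inputMem T b x₀ y) (fun _ _ => rfl) hT hx hy
    (abs_sub_le_two_pow_inputLength T b x₀ y) (card_mul_le_size_inputBudget T b x₀ y) le_rfl
    (bounded_inputMem T b x₀ y)
  refine ⟨t, σ, ?_, ht, hσ⟩
  have hwidth : bitLength ((inputBudget T b x₀ y).size ^ (inputBudget T b x₀ y).width) =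
      (3 * inputLength T b x₀ y + 1) * decomposeProg.width + 2 := by
    rw [← bitLength_two_pow, pow_mul]
    rfl
  simpa [hwidth] using hexec
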